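/- \textbf{Setting.} Let $R$ be a commutative ring and $q\in R$ (for example $R=\mathbf{k}(q)$, the field of rational functions over a field $\mathbf{k}$, with $q$ the variable). Let $QSym\subset R[[x_1,x_2,\ldots]]$ be the Hopf algebra of quasisymmetric functions (series of bounded degree in which, for each composition $\alpha=(\alpha_1,\ldots,\alpha_k)$, all monomials $x_{i_1}^{\alpha_1}\cdots x_{i_k}^{\alpha_k}$ with $i_1<\cdots<i_k$ have the same coefficient), with monomial basis $M_\alpha=\sum_{i_1<\cdots<i_k}x_{i_1}^{\alpha_1}\cdots x_{i_k}^{\alpha_k}$, coproduct $\Delta M_\alpha=\sum_{\alpha=\beta\cdot\gamma}M_\beta\otimes M_\gamma$ (deconcatenation) and antipode $S$. For a polyhedron $C\subseteq\mathbb{R}^n$ let $L(C)$ be the set of its nonempty faces (including $C$), let $f(C,t)=\sum_i f_i t^i$, where $f_i$ is the number of $i$-dimensional faces, and for $G\in L(C)$ let $C_G=\{\omega\in\mathbb{R}^n:\langle\omega,y\rangle\le\langle\omega,x\rangle\text{ for all }x\in G,\ y\in C\}$ be the normal cone of $C$ at $G$, with relative interior $C_G^\circ$. Put $$F_q(C)=\sum_{G\in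 L(C)}q^{\dim G}\sum_{\omega\in\mathbb{Z}_{>0}^n\cap C_G^\circ}x_{\omega_1}x_{\omega_2}\cdots x_{\omega_n}.$$ Let $P$ be a poset on $[n]=\{1,\ldots,n\}$. Its poset cone is $C(P)=\mathrm{cone}\{e_i-e_j: i<_P j\}\subseteq\mathbb{R}^n$. A subset $S\subseteq[n]$ is an ideal of $P$ if no element of $[n]\setminus S$ is less than an element of $S$. A flag of ideals of $P$ is a flag $\mathcal{G}:\emptyset=G_0\subsetneq G_1\subsetneq\cdots\subsetneq G_k=[n]$ in which every $G_i$ is an ideal of $P$; $\mathfrak{F}(P)$ is the set of all of them, and $P/\mathcal{G}$ is the poset on $[n]$ that is the disjoint union of the restrictions of $P$ to the blocks $G_i\setminus G_{i-1}$. For a flag $\mathcal{G}$ of subsets of $[n]$, the opposite flag $\mathcal{G}^{op}$ consists of the complements $[n]\setminus G_i$, and $M_{\mathcal{G}}=\sum_\omega x_{\omega_1}\cdots x_{\omega_n}$, where $\omega$ runs over the vectors in $\mathbb{Z}_{>0}^n$ that are constant on each block of $\mathcal{G}$ and strictly increasing from each block to the next; equivalently $M_{\mathcal G}=M_\alpha$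 with $\alpha=(|G_1\setminus G_0|,\ldots,|G_k\setminus G_{k-1}|)$. \textbf{Theorem.} For every poset $P$ on $[n]$, the series $F_q(C(P))$ is quasisymmetric, and $$S\bigl(F_q(C(P))\bigr)=(-1)^n\sum_{\mathcal{G}\in\mathfrak{F}(P)}f\bigl(C(P/\mathcal{G}),-q\bigr)\,M_{\mathcal{G}^{op}}.$$ -/

import Mathlib

noncomputable section

open scoped TensorProduct

/-! ### Quasisymmetric functions -/

namespace QuasiSymm

/-- The composition of a monomial: the sequence of its nonzero exponents, read in the order of the
variables `x₁ < x₂ < ⋯`. A composition is a list of positive integers. -/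
def shape (m : ℕ+ →₀ ℕ) : List ℕ+ :=
  (m.support.sort (· ≤ ·)).map fun i => (m i).toPNat'

@[simp] theorem shape_zero : shape 0 = [] := by simp [shape]

/-- Prepend a possibly zero part to a composition. -/
def consPart (a : ℕ) (α : List ℕ+) : List ℕ+ := if a = 0 then α else a.toPNat' :: α

theorem consPart_append (a : ℕ) (α β : List ℕ+) :
    consPart a (α ++ β) = consPart a α ++ β := by
  unfold consPart; split <;> simp

theorem shape_single_add (i : ℕ+) (a : ℕ) (m : ℕ+ →₀ ℕ) (h : ∀ j ∈ m.support, i < j) :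
    shape (Finsupp.single i a + m) = consPart a (shape m) := by
  unfold consPart
  split_ifs with ha
  · simp [ha]
  have hi : i ∉ m.support := fun hh => lt_irrefl _ (h i hh)
  have hs : (Finsupp.single i a + m).support = Finset.cons i m.support hi :=
    Finsupp.support_single_add hi ha
  unfold shape
  rw [hs, Finset.sort_cons _ (fun b hb => (h b hb).le), List.map_cons]
  congr 1
  · simp [Finsupp.notMem_support_iff.mp hi]
  · refine List.map_congr_left fun j hj => ?_
    have hj' : j ∈ m.support := (Finset.mem_sort _).mp hj
    have : i ≠ j := (h j hj').ne
    simp [this]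

theorem shape_single_add_pnat (i a : ℕ+) (m : ℕ+ →₀ ℕ) (h : ∀ j ∈ m.support, i < j) :
    shape (Finsupp.single i (a : ℕ) + m) = a :: shape m := by
  rw [shape_single_add i a m h]; simp [consPart]

/-- The monomial with composition `α` in the consecutive variables `x_j, x_{j+1}, …`. -/
def stdExp : ℕ+ → List ℕ+ → (ℕ+ →₀ ℕ)
  | _, [] => 0
  | j, a :: α => Finsupp.single j (a : ℕ) + stdExp (j + 1) α

theorem le_of_mem_stdExp (α : List ℕ+) : ∀ (j : ℕ+), ∀ i ∈ (stdExp j α).support, j ≤ i := by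
  induction α with
  | nil => simp [stdExp]
  | cons a α ih =>
    intro j i hi
    rw [stdExp] at hi
    rcases Finset.mem_union.mp (Finsupp.support_add hi) with h | h
    · have := Finsupp.support_single_subset h
      simp only [Finset.mem_singleton] at this
      exact this.ge
    · exact (PNat.lt_add_right j 1).le.trans (ih _ _ h)

@[simp] theorem shape_stdExp (α : List ℕ+) : ∀ j : ℕ+, shape (stdExp j α) = α := by
  induction α with
  | nil => simp [stdExp]
  | cons a α ih =>
    intro j
    rw [stdExp, shape_single_add_pnat, ih]
    exact fun i hi => (PNat.lt_add_right j 1).trans_le (le_of_mem_stdExp α _ i hi)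

theorem degree_eq_shape_sum (m : ℕ+ →₀ ℕ) :
    m.degree = ((shape m).map (fun a : ℕ+ => (a : ℕ))).sum := by
  induction m using Finsupp.induction_on_min with
  | zero => simp
  | single_add i a m h ha ih =>
    rw [shape_single_add i a m h, map_add, ih]
    simp [consPart, ha, Finsupp.degree_single, Nat.toPNat'_coe, Nat.pos_of_ne_zero ha]

theorem shape_eq_nil {m : ℕ+ →₀ ℕ} : shape m = [] ↔ m = 0 := by
  simp [shape, ← List.length_eq_zero_iff]

variable {R : Type*} [CommRing R]

/-- Sum of `h β γ` over the ways to write `α` as a termwise sum of two sequences of nonnegative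
integers, with `β` and `γ` obtained from these by deleting zeros. -/
def splitSum : List ℕ+ → (List ℕ+ → List ℕ+ → R) → R
  | [], h => h [] []
  | a :: α, h => ∑ p ∈ Finset.HasAntidiagonal.antidiagonal (a : ℕ),
      splitSum α fun β γ => h (consPart p.1 β) (consPart p.2 γ)

theorem splitSum_zero (α : List ℕ+) : splitSum α (fun _ _ => (0 : R)) = 0 := by
  induction α with
  | nil => rfl
  | cons a α ih => simp [splitSum, ih]

theorem splitSum_add (α : List ℕ+) : ∀ (g h : List ℕ+ → List ℕ+ → R),
    splitSum α (fun β γ => g β γ + h β γ) = splitSum α g + splitSum α h := by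
  induction α with
  | nil => intro g h; rfl
  | cons a α ih => intro g h; simp [splitSum, ih, Finset.sum_add_distrib]

theorem splitSum_mul_left (α : List ℕ+) (c : R) : ∀ (h : List ℕ+ → List ℕ+ → R),
    splitSum α (fun β γ => c * h β γ) = c * splitSum α h := by
  induction α with
  | nil => intro h; rfl
  | cons a α ih => intro h; simp [splitSum, ih, Finset.mul_sum]

theorem splitSum_mul_right (α : List ℕ+) (c : R) (h : List ℕ+ → List ℕ+ → R) :
    splitSum α (fun β γ => h β γ * c) = splitSum α h * c := by
  simp only [mul_comm _ c, splitSum_mul_left]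

theorem splitSum_append (α α' : List ℕ+) : ∀ (h : List ℕ+ → List ℕ+ → R),
    splitSum (α ++ α') h =
      splitSum α fun β γ => splitSum α' fun β' γ' => h (β ++ β') (γ ++ γ') := by
  induction α with
  | nil => intro h; rfl
  | cons a α ih => intro h; simp [splitSum, ih, consPart_append]

theorem sum_antidiagonal_single_add (i : ℕ+) (a : ℕ) (m : ℕ+ →₀ ℕ) (hi : i ∉ m.support)
    (f : (ℕ+ →₀ ℕ) → (ℕ+ →₀ ℕ) → R) :
    ∑ p ∈ Finset.HasAntidiagonal.antidiagonal (Finsupp.single i a + m), f p.1 p.2 =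
      ∑ s ∈ Finset.HasAntidiagonal.antidiagonal a, ∑ p ∈ Finset.HasAntidiagonal.antidiagonal m,
        f (Finsupp.single i s.1 + p.1) (Finsupp.single i s.2 + p.2) := by
  rw [← Finset.sum_product']
  have him : m i = 0 := Finsupp.notMem_support_iff.mp hi
  symm
  refine Finset.sum_bij'
    (fun x _ => (Finsupp.single i x.1.1 + x.2.1, Finsupp.single i x.1.2 + x.2.2))
    (fun p _ => ((p.1 i, p.2 i), (p.1.erase i, p.2.erase i))) ?_ ?_ ?_ ?_ ?_
  · rintro ⟨⟨s, t⟩, ⟨u, v⟩⟩ h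
    simp only [Finset.mem_product, Finset.HasAntidiagonal.mem_antidiagonal] at h ⊢
    rw [← h.1, ← h.2, Finsupp.single_add]
    abel
  · rintro ⟨u, v⟩ h
    simp only [Finset.mem_product, Finset.HasAntidiagonal.mem_antidiagonal] at h ⊢
    refine ⟨?_, ?_⟩
    · have := DFunLike.congr_fun h i
      simpa [him] using this
    · rw [← Finsupp.erase_add, h, Finsupp.erase_add, Finsupp.erase_single, zero_add,
        Finsupp.erase_of_notMem_support hi]
  · rintro ⟨⟨s, t⟩, ⟨u, v⟩⟩ h
    simp only [Finset.mem_product, Finset.HasAntidiagonal.mem_antidiagonal] at h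
    have huv : u i + v i = 0 := by
      have := DFunLike.congr_fun h.2 i
      simpa [him] using this
    have hu : u i = 0 := by omega
    have hv : v i = 0 := by omega
    simp [Finsupp.erase_add, hu, hv, Finsupp.erase_of_notMem_support]
  · rintro ⟨u, v⟩ h
    simp [Finsupp.single_add_erase]
  · rintro ⟨⟨s, t⟩, ⟨u, v⟩⟩ h
    rfl

theorem sum_antidiagonal_shape (m : ℕ+ →₀ ℕ) : ∀ (h : List ℕ+ → List ℕ+ → R),
    ∑ p ∈ Finset.HasAntidiagonal.antidiagonal m, h (shape p.1) (shape p.2) = splitSum (shape m) h := by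
  induction m using Finsupp.induction_on_min with
  | zero => intro h; simp [splitSum]
  | single_add i a m hm ha ih =>
    intro h
    have hi : i ∉ m.support := fun hh => lt_irrefl _ (hm i hh)
    rw [sum_antidiagonal_single_add i a m hi (fun u v => h (shape u) (shape v)),
      shape_single_add i a m hm]
    have ha' : ((a.toPNat' : ℕ+) : ℕ) = a := by
      simp [Nat.toPNat'_coe, Nat.pos_of_ne_zero ha]
    rw [consPart, if_neg ha, splitSum, ha']
    refine Finset.sum_congr rfl fun s _ => ?_
    rw [← ih]
    refine Finset.sum_congr rfl fun p hp => ?_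
    rw [Finset.HasAntidiagonal.mem_antidiagonal] at hp
    rw [shape_single_add, shape_single_add]
    · intro j hj
      refine hm j ?_
      rw [← hp]
      simp only [Finsupp.mem_support_iff, Finsupp.add_apply] at hj ⊢
      omega
    · intro j hj
      refine hm j ?_
      rw [← hp]
      simp only [Finsupp.mem_support_iff, Finsupp.add_apply] at hj ⊢
      omega

/-- The formal power series with coefficients `c`. -/
def ofCoeff (c : (ℕ+ →₀ ℕ) → R) : MvPowerSeries ℕ+ R := c

@[simp] theorem coeff_ofCoeff (c : (ℕ+ →₀ ℕ) → R) (m : ℕ+ →₀ ℕ) :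
    MvPowerSeries.coeff m (ofCoeff c) = c m := rfl

variable (R) in
/-- The algebra `QSym` of quasisymmetric functions: formal power series of bounded degree in
`x₁ < x₂ < ⋯` such that for all `i₁ < ⋯ < i_k` and `j₁ < ⋯ < j_k` the monomials
`x_{i₁}^{α₁} ⋯ x_{i_k}^{α_k}` and `x_{j₁}^{α₁} ⋯ x_{j_k}^{α_k}` have the same coefficient. -/
def QSym : Subalgebra R (MvPowerSeries ℕ+ R) where
  carrier := {f | (∀ m m' : ℕ+ →₀ ℕ, shape m = shape m' →
      MvPowerSeries.coeff m f = MvPowerSeries.coeff m' f) ∧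
    ∃ d : ℕ, ∀ m : ℕ+ →₀ ℕ, d < m.degree → MvPowerSeries.coeff m f = 0}
  mul_mem' := by
    rintro f g ⟨hf, d, hd⟩ ⟨hg, e, he⟩
    refine ⟨fun m m' h => ?_, d + e, fun m hm => ?_⟩
    · have key : ∀ n : ℕ+ →₀ ℕ, MvPowerSeries.coeff n (f * g) = splitSum (shape n) fun β γ =>
          MvPowerSeries.coeff (stdExp 1 β) f * MvPowerSeries.coeff (stdExp 1 γ) g := by
        intro n
        rw [MvPowerSeries.coeff_mul, ← sum_antidiagonal_shape]
        refine Finset.sum_congr rfl fun p _ => ?_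
        rw [hf p.1 (stdExp 1 (shape p.1)) (by simp), hg p.2 (stdExp 1 (shape p.2)) (by simp)]
      rw [key, key, h]
    · rw [MvPowerSeries.coeff_mul]
      refine Finset.sum_eq_zero fun p hp => ?_
      rw [Finset.HasAntidiagonal.mem_antidiagonal] at hp
      have hp' : p.1.degree + p.2.degree = m.degree := by rw [← hp, map_add]
      rcases lt_or_ge d p.1.degree with h | h
      · rw [hd _ h, zero_mul]
      · rw [he p.2 (by omega), mul_zero]
  add_mem' := by
    rintro f g ⟨hf, d, hd⟩ ⟨hg, e, he⟩
    refine ⟨fun m m' h => ?_, d + e, fun m hm => ?_⟩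
    · rw [map_add, map_add, hf m m' h, hg m m' h]
    · rw [map_add, hd m (by omega), he m (by omega), add_zero]
  algebraMap_mem' := by
    intro r
    refine ⟨fun m m' h => ?_, 0, fun m hm => ?_⟩
    · classical
      simp only [MvPowerSeries.algebraMap_apply, Algebra.algebraMap_self, RingHom.id_apply,
        MvPowerSeries.coeff_C]
      simp only [← shape_eq_nil, h]
    · classical
      have : m ≠ 0 := by rintro rfl; simp at hm
      simp [MvPowerSeries.algebraMap_apply, MvPowerSeries.coeff_C, this]

variable (R) in
/-- The monomial quasisymmetric function
`M_α = ∑_{i₁ < ⋯ < i_k} x_{i₁}^{α₁} ⋯ x_{i_k}^{α_k}`, the sum of all monomials of shape `α`. -/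
def M (α : List ℕ+) : QSym R :=
  ⟨ofCoeff fun m => if shape m = α then 1 else 0, by
    refine ⟨fun m m' h => ?_, (α.map (fun a : ℕ+ => (a : ℕ))).sum, fun m hm => ?_⟩
    · simp only [coeff_ofCoeff, h]
    · have : shape m ≠ α := by
        rintro rfl
        exact hm.ne' (degree_eq_shape_sum m)
      simp [this]⟩

theorem finite_sum_le (d : ℕ) :
    {α : List ℕ+ | (α.map (fun a : ℕ+ => (a : ℕ))).sum ≤ d}.Finite := by
  have h : (⋃ n ∈ Finset.range (d + 1), Set.range
      fun c : Composition n => c.blocks.map Nat.toPNat').Finite :=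
    Set.Finite.biUnion (Finset.finite_toSet _) fun n _ => Set.finite_range _
  refine h.subset fun α hα => ?_
  simp only [Set.mem_iUnion, Set.mem_range]
  refine ⟨_, Finset.mem_range.mpr (Nat.lt_succ_of_le hα),
    ⟨α.map (fun a : ℕ+ => (a : ℕ)), ?_, rfl⟩, ?_⟩
  · intro i hi
    obtain ⟨a, -, rfl⟩ := List.mem_map.mp hi
    exact a.pos
  · simp [Function.comp_def]

/-- The coefficient of `M_α` in a quasisymmetric function. -/
def mcoeff (f : QSym R) (α : List ℕ+) : R := MvPowerSeries.coeff (stdExp 1 α) (f : MvPowerSeries ℕ+ R)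

theorem coeff_eq_mcoeff (f : QSym R) (m : ℕ+ →₀ ℕ) :
    MvPowerSeries.coeff m (f : MvPowerSeries ℕ+ R) = mcoeff f (shape m) :=
  f.2.1 _ _ (by simp)

theorem ext_mcoeff {f g : QSym R} (h : ∀ α, mcoeff f α = mcoeff g α) : f = g :=
  Subtype.ext <| MvPowerSeries.ext fun m => by
    rw [coeff_eq_mcoeff, coeff_eq_mcoeff, h]

theorem mcoeff_M (α β : List ℕ+) : mcoeff (M R α) β = if β = α then 1 else 0 := by
  simp [mcoeff, M]

theorem mcoeff_add (f g : QSym R) (α : List ℕ+) :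
    mcoeff (f + g) α = mcoeff f α + mcoeff g α := by simp [mcoeff]

theorem mcoeff_smul (r : R) (f : QSym R) (α : List ℕ+) :
    mcoeff (r • f) α = r * mcoeff f α := by simp [mcoeff]

theorem mcoeff_mul (f g : QSym R) (α : List ℕ+) :
    mcoeff (f * g) α = splitSum α fun β γ => mcoeff f β * mcoeff g γ := by
  rw [mcoeff, MulMemClass.coe_mul, MvPowerSeries.coeff_mul]
  simp only [coeff_eq_mcoeff]
  rw [sum_antidiagonal_shape _ (fun β γ => mcoeff f β * mcoeff g γ), shape_stdExp]

theorem mcoeff_one (α : List ℕ+) : mcoeff (1 : QSym R) α = if α = [] then 1 else 0 := by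
  classical
  rw [mcoeff, OneMemClass.coe_one, MvPowerSeries.coeff_one]
  simp only [← shape_eq_nil, shape_stdExp]

theorem M_nil : M R [] = 1 := ext_mcoeff fun α => by rw [mcoeff_M, mcoeff_one]

theorem finite_mcoeff (f : QSym R) : (Function.support (mcoeff f)).Finite := by
  obtain ⟨d, hd⟩ := f.2.2
  refine (finite_sum_le d).subset fun α hα => ?_
  by_contra hlt
  refine hα (hd _ ?_)
  rw [degree_eq_shape_sum, shape_stdExp]
  simpa using hlt

variable (R) in
/-- The monomial basis `(M_α)` of `QSym`. -/
def basis : Module.Basis (List ℕ+) R (QSym R) := .ofRepr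
  { toFun := fun f => Finsupp.ofSupportFinite (mcoeff f) (finite_mcoeff f)
    map_add' := fun f g => Finsupp.ext fun α => mcoeff_add f g α
    map_smul' := fun r f => Finsupp.ext fun α => mcoeff_smul r f α
    invFun := fun c => c.sum fun α r => r • M R α
    left_inv := fun f => ext_mcoeff fun β => by
      let L : QSym R →ₗ[R] R :=
        { toFun := fun f => mcoeff f β, map_add' := fun f g => mcoeff_add f g β,
          map_smul' := fun r f => mcoeff_smul r f β }
      change L _ = _
      rw [map_finsuppSum]
      simp only [map_smul]
      change (Finsupp.sum _ fun α r => r • mcoeff (M R α) β) = _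
      simp only [mcoeff_M, smul_eq_mul, mul_ite, mul_one, mul_zero]
      rw [Finsupp.sum_ite_eq]
      split_ifs with h
      · rfl
      · exact (Finsupp.notMem_support_iff.mp h).symm
    right_inv := fun c => Finsupp.ext fun β => by
      let L : QSym R →ₗ[R] R :=
        { toFun := fun f => mcoeff f β, map_add' := fun f g => mcoeff_add f g β,
          map_smul' := fun r f => mcoeff_smul r f β }
      change L _ = _
      rw [map_finsuppSum]
      simp only [map_smul]
      change (Finsupp.sum _ fun α r => r • mcoeff (M R α) β) = _
      simp only [mcoeff_M, smul_eq_mul, mul_ite, mul_one, mul_zero]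
      rw [Finsupp.sum_ite_eq]
      split_ifs with h
      · rfl
      · exact (Finsupp.notMem_support_iff.mp h).symm }

theorem basis_repr (f : QSym R) (α : List ℕ+) : (basis R).repr f α = mcoeff f α := rfl

theorem basis_apply (α : List ℕ+) : basis R α = M R α := by
  change Finsupp.sum (Finsupp.single α 1) (fun α r => r • M R α) = _
  rw [Finsupp.sum_single_index] <;> simp

variable (R) in
/-- The deconcatenation coproduct `Δ M_α = ∑_{α = β · γ} M_β ⊗ M_γ`. -/
def comulMap : QSym R →ₗ[R] QSym R ⊗[R] QSym R :=
  (basis R).constr R fun α =>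
    ∑ i ∈ Finset.range (α.length + 1), M R (α.take i) ⊗ₜ[R] M R (α.drop i)

variable (R) in
/-- The counit: the constant term, `ε M_∅ = 1` and `ε M_α = 0` for `α ≠ ∅`. -/
def counitMap : QSym R →ₗ[R] R :=
  (basis R).constr R fun α => if α = [] then 1 else 0

theorem comulMap_M (α : List ℕ+) : comulMap R (M R α) =
    ∑ i ∈ Finset.range (α.length + 1), M R (α.take i) ⊗ₜ[R] M R (α.drop i) := by
  rw [← basis_apply, comulMap, Module.Basis.constr_basis]

theorem counitMap_M (α : List ℕ+) : counitMap R (M R α) = if α = [] then 1 else 0 := by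
  rw [← basis_apply, counitMap, Module.Basis.constr_basis]

theorem lin_ext {N : Type*} [AddCommMonoid N] [Module R N] {f g : QSym R →ₗ[R] N}
    (h : ∀ α, f (M R α) = g (M R α)) : f = g :=
  (basis R).ext fun α => by rw [basis_apply, h]

variable (R) in
/-- The coefficient of `M_α`, as a linear functional. -/
def mcoeffL (α : List ℕ+) : QSym R →ₗ[R] R where
  toFun f := mcoeff f α
  map_add' f g := mcoeff_add f g α
  map_smul' r f := mcoeff_smul r f α

@[simp] theorem mcoeffL_apply (α : List ℕ+) (f : QSym R) : mcoeffL R α f = mcoeff f α := rfl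

theorem counitMap_apply (f : QSym R) : counitMap R f = mcoeff f [] := by
  have : counitMap R = mcoeffL R [] := lin_ext fun α => by
    simp [counitMap_M, mcoeff_M, eq_comm]
  rw [this, mcoeffL_apply]

variable (R) in
/-- The coefficient of `M_β ⊗ M_γ`, as a linear functional. -/
def mcoeff₂ (β γ : List ℕ+) : QSym R ⊗[R] QSym R →ₗ[R] R :=
  LinearMap.mul' R R ∘ₗ TensorProduct.map (mcoeffL R β) (mcoeffL R γ)

@[simp] theorem mcoeff₂_tmul (β γ : List ℕ+) (f g : QSym R) :
    mcoeff₂ R β γ (f ⊗ₜ g) = mcoeff f β * mcoeff g γ := rfl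

theorem ext_mcoeff₂ {s t : QSym R ⊗[R] QSym R} (h : ∀ β γ, mcoeff₂ R β γ s = mcoeff₂ R β γ t) :
    s = t := by
  refine ((basis R).tensorProduct (basis R)).ext_elem fun p => ?_
  have key : ∀ u : QSym R ⊗[R] QSym R,
      ((basis R).tensorProduct (basis R)).repr u p = mcoeff₂ R p.1 p.2 u := by
    intro u
    induction u using TensorProduct.induction_on with
    | zero => simp
    | tmul f g =>
      rw [Module.Basis.tensorProduct_repr_tmul_apply, mcoeff₂_tmul, basis_repr, basis_repr,
        smul_eq_mul, mul_comm]
    | add u v hu hv => rw [map_add, Finsupp.add_apply, hu, hv, map_add]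
  rw [key, key, h]

theorem mcoeff₂_comul (f : QSym R) (β γ : List ℕ+) :
    mcoeff₂ R β γ (comulMap R f) = mcoeff f (β ++ γ) := by
  have : mcoeff₂ R β γ ∘ₗ comulMap R = mcoeffL R (β ++ γ) := lin_ext fun α => by
    rw [LinearMap.comp_apply, comulMap_M, map_sum, mcoeffL_apply, mcoeff_M]
    simp only [mcoeff₂_tmul, mcoeff_M]
    split_ifs with h
    · subst h
      rw [Finset.sum_eq_single β.length]
      · simp
      · intro i hi hne
        rw [if_neg, zero_mul]
        intro hβ
        have := congrArg List.length hβ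
        simp only [List.length_append, Finset.mem_range, List.length_take] at this hi
        omega
      · intro hh
        simp at hh
    · refine Finset.sum_eq_zero fun i _ => ?_
      by_cases h1 : β = α.take i
      · by_cases h2 : γ = α.drop i
        · exact absurd (by rw [h1, h2, List.take_append_drop]) h
        · simp [h2]
      · simp [h1]
  exact LinearMap.congr_fun this f

theorem mcoeff₂_mul (s t : QSym R ⊗[R] QSym R) (β γ : List ℕ+) :
    mcoeff₂ R β γ (s * t) = splitSum β fun b c => splitSum γ fun b' c' =>
      mcoeff₂ R b b' s * mcoeff₂ R c c' t := by
  induction s using TensorProduct.induction_on with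
  | zero => simp [splitSum_zero]
  | add u v hu hv => simp only [add_mul, map_add, hu, hv, splitSum_add]
  | tmul f f' =>
    induction t using TensorProduct.induction_on with
    | zero => simp [splitSum_zero]
    | add u v hu hv => simp only [mul_add, map_add, hu, hv, splitSum_add]
    | tmul g g' =>
      rw [Algebra.TensorProduct.tmul_mul_tmul, mcoeff₂_tmul, mcoeff_mul, mcoeff_mul,
        ← splitSum_mul_right]
      simp only [← splitSum_mul_left, mcoeff₂_tmul]
      simp only [mul_mul_mul_comm]

theorem comulMap_mul (f g : QSym R) : comulMap R (f * g) = comulMap R f * comulMap R g :=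
  ext_mcoeff₂ fun β γ => by
    rw [mcoeff₂_comul, mcoeff₂_mul, mcoeff_mul, splitSum_append]
    simp only [mcoeff₂_comul]

theorem comulMap_one : comulMap R 1 = 1 := by
  rw [← M_nil, comulMap_M]
  simp [M_nil, Algebra.TensorProduct.one_def]

instance : Coalgebra R (QSym R) where
  comul := comulMap R
  counit := counitMap R
  coassoc := by
    let mcoeff₃ (β γ δ : List ℕ+) : QSym R ⊗[R] (QSym R ⊗[R] QSym R) →ₗ[R] R :=
      LinearMap.mul' R R ∘ₗ TensorProduct.map (mcoeffL R β) (mcoeff₂ R γ δ)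
    have ext₃ : ∀ s t : QSym R ⊗[R] (QSym R ⊗[R] QSym R),
        (∀ β γ δ, mcoeff₃ β γ δ s = mcoeff₃ β γ δ t) → s = t := by
      intro s t h
      refine ((basis R).tensorProduct ((basis R).tensorProduct (basis R))).ext_elem fun p => ?_
      have key : ∀ u : QSym R ⊗[R] (QSym R ⊗[R] QSym R),
          ((basis R).tensorProduct ((basis R).tensorProduct (basis R))).repr u p =
            mcoeff₃ p.1 p.2.1 p.2.2 u := by
        have : (Finsupp.lapply p ∘ₗ
            (((basis R).tensorProduct ((basis R).tensorProduct (basis R))).repr :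
              _ →ₗ[R] _)) = mcoeff₃ p.1 p.2.1 p.2.2 := by
          refine TensorProduct.ext_threefold' fun f g k => ?_
          simp only [LinearMap.comp_apply, LinearEquiv.coe_coe, Finsupp.lapply_apply]
          obtain ⟨a, b, c⟩ := p
          rw [Module.Basis.tensorProduct_repr_tmul_apply,
            Module.Basis.tensorProduct_repr_tmul_apply]
          simp only [mcoeff₃, LinearMap.comp_apply, TensorProduct.map_tmul, mcoeff₂_tmul,
            LinearMap.mul'_apply, mcoeffL_apply, basis_repr, smul_eq_mul]
          ring
        exact fun u => LinearMap.congr_fun this u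
      rw [key, key, h]
    refine LinearMap.ext fun f => ext₃ _ _ fun β γ δ => ?_
    have h1 : ∀ u : QSym R ⊗[R] QSym R,
        mcoeff₃ β γ δ (TensorProduct.assoc R _ _ _ ((comulMap R).rTensor _ u)) =
          mcoeff₂ R (β ++ γ) δ u := by
      intro u
      induction u using TensorProduct.induction_on with
      | zero => rw [LinearMap.map_zero, LinearEquiv.map_zero, LinearMap.map_zero, LinearMap.map_zero]
      | add u v hu hv => simp only [map_add, hu, hv]
      | tmul f g =>
        rw [LinearMap.rTensor_tmul, mcoeff₂_tmul, ← mcoeff₂_comul]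
        induction comulMap R f using TensorProduct.induction_on with
        | zero => simp only [TensorProduct.zero_tmul, map_zero, zero_mul]
        | add u v hu hv => simp only [TensorProduct.add_tmul, map_add, hu, hv, add_mul]
        | tmul a b => simp [mcoeff₃, mul_assoc]
    have h2 : ∀ u : QSym R ⊗[R] QSym R,
        mcoeff₃ β γ δ ((comulMap R).lTensor _ u) = mcoeff₂ R β (γ ++ δ) u := by
      intro u
      induction u using TensorProduct.induction_on with
      | zero => simp
      | add u v hu hv => simp only [map_add, hu, hv]
      | tmul f g => simp [mcoeff₃, mcoeff₂_comul]
    simp only [LinearMap.comp_apply, LinearEquiv.coe_coe]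
    rw [h1, h2, mcoeff₂_comul, mcoeff₂_comul, List.append_assoc]
  rTensor_counit_comp_comul := lin_ext fun α => by
    rw [LinearMap.comp_apply, comulMap_M, map_sum, Finset.sum_eq_single 0]
    · simp [counitMap_M]
    · intro i hi hne
      have : α.take i ≠ [] := by
        intro h
        simp only [List.take_eq_nil_iff, Finset.mem_range] at h hi
        rcases h with h | h
        · exact hne h
        · subst h; simp at hi; omega
      simp [counitMap_M, this]
    · simp
  lTensor_counit_comp_comul := lin_ext fun α => by
    rw [LinearMap.comp_apply, comulMap_M, map_sum, Finset.sum_eq_single α.length]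
    · simp [counitMap_M]
    · intro i hi hne
      have : α.drop i ≠ [] := by
        intro h
        simp only [List.drop_eq_nil_iff, Finset.mem_range] at h hi
        omega
      simp [counitMap_M, this]
    · simp

instance : Bialgebra R (QSym R) :=
  Bialgebra.mk' R (QSym R)
    (by change counitMap R 1 = 1; rw [counitMap_apply, mcoeff_one, if_pos rfl])
    (by
      intro f g
      change counitMap R (f * g) = counitMap R f * counitMap R g
      rw [counitMap_apply, counitMap_apply, counitMap_apply, mcoeff_mul, splitSum])
    comulMap_one
    (fun {f g} => comulMap_mul f g)

theorem comul_M (α : List ℕ+) : Coalgebra.comul (R := R) (M R α) =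
    ∑ i ∈ Finset.range (α.length + 1), M R (α.take i) ⊗ₜ[R] M R (α.drop i) := comulMap_M α

theorem counit_M (α : List ℕ+) :
    Coalgebra.counit (R := R) (M R α) = if α = [] then 1 else 0 := counitMap_M α

variable (R) in
/-- The antipode on the monomial basis, by the recursion
`S(M_∅) = 1`, `S(M_α) = -∑_{α = β · γ, γ ≠ ∅} S(M_β) M_γ` for `α ≠ ∅`. -/
def antipodeM (α : List ℕ+) : QSym R :=
  if α = [] then 1 else -∑ i : Fin α.length, antipodeM (α.take i) * M R (α.drop i)
termination_by α.length
decreasing_by simp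

variable (R) in
/-- The same with the factors in the other order; used to see that `antipodeM` is two-sided. -/
def antipodeM' (α : List ℕ+) : QSym R :=
  if α = [] then 1 else
    -∑ i : Fin α.length, M R (α.take (i + 1)) * antipodeM' (α.drop (i + 1))
termination_by α.length
decreasing_by
  have := i.2
  simp only [List.length_drop]
  omega

variable (R) in
/-- The antipode of `QSym`. -/
def antipodeMap : QSym R →ₗ[R] QSym R := (basis R).constr R (antipodeM R)

theorem antipodeMap_M (α : List ℕ+) : antipodeMap R (M R α) = antipodeM R α := by
  rw [← basis_apply, antipodeMap, Module.Basis.constr_basis]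

theorem antipode_conv_id :
    WithConv.toConv (antipodeMap R) * WithConv.toConv LinearMap.id = 1 := by
  rw [LinearMap.convMul_def, LinearMap.convOne_def]
  congr 1
  refine lin_ext fun α => ?_
  simp only [LinearMap.comp_apply, comul_M, counit_M, map_sum]
  rw [Finset.sum_range_succ]
  simp only [TensorProduct.map_tmul, LinearMap.mul'_apply, antipodeMap_M, LinearMap.id_apply,
    List.take_length, List.drop_length, M_nil, mul_one]
  rcases eq_or_ne α [] with rfl | h
  · rw [antipodeM]; simp
  · rw [antipodeM, if_neg h, if_neg h, Fin.sum_univ_eq_sum_range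
      (fun i => antipodeM R (α.take i) * M R (α.drop i))]
    simp

theorem exists_id_conv :
    ∃ T : WithConv (QSym R →ₗ[R] QSym R), WithConv.toConv LinearMap.id * T = 1 := by
  refine ⟨WithConv.toConv ((basis R).constr R (antipodeM' R)), ?_⟩
  have hT : ∀ α, (basis R).constr R (antipodeM' R) (M R α) = antipodeM' R α := fun α => by
    rw [← basis_apply, Module.Basis.constr_basis]
  rw [LinearMap.convMul_def, LinearMap.convOne_def]
  congr 1
  refine lin_ext fun α => ?_
  simp only [LinearMap.comp_apply, comul_M, counit_M, map_sum]
  rw [Finset.sum_range_succ']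
  simp only [TensorProduct.map_tmul, LinearMap.mul'_apply, hT, LinearMap.id_apply,
    List.take_zero, List.drop_zero, M_nil, one_mul]
  rcases eq_or_ne α [] with rfl | h
  · rw [antipodeM']; simp
  · conv_lhs => rw [antipodeM', if_neg h]
    rw [if_neg h, Fin.sum_univ_eq_sum_range
      (fun i => M R (α.take (i + 1)) * antipodeM' R (α.drop (i + 1)))]
    simp

theorem id_conv_antipode :
    WithConv.toConv LinearMap.id * WithConv.toConv (antipodeMap R) = 1 := by
  obtain ⟨T, hT⟩ := exists_id_conv (R := R)
  rwa [left_inv_eq_right_inv antipode_conv_id hT]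

/-- The Hopf algebra of quasisymmetric functions. -/
instance : HopfAlgebra R (QSym R) where
  antipode := antipodeMap R
  mul_antipode_rTensor_comul := WithConv.toConv_injective antipode_conv_id
  mul_antipode_lTensor_comul := WithConv.toConv_injective id_conv_antipode

end QuasiSymm

/-! ### Polyhedra, their faces, and weighted enumerators -/

namespace PosetCone

variable {n : ℕ}

/-- The (nonempty) faces of a polyhedron `C`: the nonempty sets of maximizers over `C` of linear
functionals, including `C` itself. -/
def faces (C : Set (Fin n → ℝ)) : Set (Set (Fin n → ℝ)) := {G | G.Nonempty ∧ IsExposed ℝ C G}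

/-- The dimension of (the affine span of) a nonempty set. -/
def dim (G : Set (Fin n → ℝ)) : ℕ := Module.finrank ℝ (vectorSpan ℝ G)

/-- The `f`-polynomial `∑ f_i X^i`, with `f_i` the number of `i`-dimensional faces. -/
def fPolynomial (C : Set (Fin n → ℝ)) : Polynomial ℤ :=
  ∑ i ∈ Finset.range (n + 1),
    Polynomial.C (({G | G ∈ faces C ∧ dim G = i}.ncard : ℕ) : ℤ) * Polynomial.X ^ i

/-- The normal cone of `C` at the face `G`: the weights maximized over `C` along all of `G`. -/
def normalCone (C G : Set (Fin n → ℝ)) : Set (Fin n → ℝ) :=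
  {ω | ∀ x ∈ G, ∀ y ∈ C, ω ⬝ᵥ y ≤ ω ⬝ᵥ x}

/-- The enumerator `∑ x_{ω₁} x_{ω₂} ⋯ x_{ω_n}` of the vectors `ω` of positive integers in `A`:
the coefficient of a monomial is the number of such `ω` that produce it. -/
def enumerator (R : Type*) [CommRing R] (A : Set (Fin n → ℝ)) : MvPowerSeries ℕ+ R :=
  QuasiSymm.ofCoeff fun m =>
    (({ω : Fin n → ℕ+ | (fun i => ((ω i : ℕ) : ℝ)) ∈ A ∧
      ∑ i, Finsupp.single (ω i) 1 = m}.ncard : ℕ) : R)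

/-- `F_q(G) = q^{dim G} ∑ x_{ω₁} ⋯ x_{ω_n}`, over positive integer vectors `ω` in the relative
interior of the normal cone of `C` at its face `G`. -/
def faceEnumerator {R : Type*} [CommRing R] (q : R) (C G : Set (Fin n → ℝ)) :
    MvPowerSeries ℕ+ R :=
  q ^ dim G • enumerator R (intrinsicInterior ℝ (normalCone C G))

/-- The weighted integer points enumerator `F_q(C) = ∑_G F_q(G)` over all faces `G` of `C`
(a polyhedron has finitely many faces). -/
def weightedEnumerator {R : Type*} [CommRing R] (q : R) (C : Set (Fin n → ℝ)) :
    MvPowerSeries ℕ+ R :=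
  ∑ᶠ G ∈ faces C, faceEnumerator q C G

/-! ### Posets on `[n]`, poset cones, flags of ideals -/

/-- The poset cone `C(P) = cone {e_i - e_j : i <_P j}`. -/
def posetCone (P : PartialOrder (Fin n)) : Set (Fin n → ℝ) :=
  (PointedCone.hull ℝ {v : Fin n → ℝ |
    ∃ i j, P.lt i j ∧ v = Pi.single i 1 - Pi.single j 1} : Set (Fin n → ℝ))

/-- `S` is an ideal of `P`: no element outside `S` is less than an element of `S`. -/
def IsIdeal (P : PartialOrder (Fin n)) (S : Finset (Fin n)) : Prop :=
  ∀ i ∉ S, ∀ j ∈ S, ¬ P.lt i j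

/-- A flag `∅ = F₀ ⊂ F₁ ⊂ ⋯ ⊂ F_k = [n]`, given as the set `{F₀, …, F_k}` of its members. -/
def IsFlag (𝓕 : Finset (Finset (Fin n))) : Prop :=
  ∅ ∈ 𝓕 ∧ Finset.univ ∈ 𝓕 ∧ ∀ A ∈ 𝓕, ∀ B ∈ 𝓕, A ⊆ B ∨ B ⊆ A

open Classical in
/-- The set of flags of ideals of `P`. -/
def idealFlags (P : PartialOrder (Fin n)) : Finset (Finset (Finset (Fin n))) :=
  {𝓕 | IsFlag 𝓕 ∧ ∀ F ∈ 𝓕, IsIdeal P F}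

/-- The opposite flag, whose members are the complements of the members of `𝓕`. -/
def opFlag (𝓕 : Finset (Finset (Fin n))) : Finset (Finset (Fin n)) := 𝓕.image fun F => Fᶜ

/-- `p` and `q` lie in the same block `F_i \ F_{i-1}` of the flag. -/
def SameBlock (𝓕 : Finset (Finset (Fin n))) (p q : Fin n) : Prop := ∀ F ∈ 𝓕, p ∈ F ↔ q ∈ F

/-- `p` lies in an earlier block of the flag than `q`. -/
def EarlierBlock (𝓕 : Finset (Finset (Fin n))) (p q : Fin n) : Prop := ∃ F ∈ 𝓕, p ∈ F ∧ q ∉ F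

/-- The relatively open braid cone of a flag: the vectors which are constant on each block
`F_i \ F_{i-1}` and strictly increase from each block to later ones. -/
def openBraidCone (𝓕 : Finset (Finset (Fin n))) : Set (Fin n → ℝ) :=
  {ω | (∀ p q, SameBlock 𝓕 p q → ω p = ω q) ∧ ∀ p q, EarlierBlock 𝓕 p q → ω p < ω q}

/-- The monomial quasisymmetric function `M_𝓕`, the enumerator of the positive integer vectors in
the relatively open braid cone of `𝓕`. -/
def flagMonomial (R : Type*) [CommRing R] (𝓕 : Finset (Finset (Fin n))) : MvPowerSeries ℕ+ R :=
  enumerator R (openBraidCone 𝓕)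

/-- The poset `P/𝓕` on `[n]`, the disjoint union of the restrictions of `P` to the blocks
`F_i \ F_{i-1}` of the flag `𝓕`. -/
@[reducible] def quotientPoset (P : PartialOrder (Fin n)) (𝓕 : Finset (Finset (Fin n))) :
    PartialOrder (Fin n) where
  le i j := P.le i j ∧ SameBlock 𝓕 i j
  lt i j := P.lt i j ∧ SameBlock 𝓕 i j
  lt_iff_le_not_ge i j := by
    have h := P.lt_iff_le_not_ge i j
    have hs : SameBlock 𝓕 i j → SameBlock 𝓕 j i := fun h F hF => (h F hF).symm
    exact ⟨fun ⟨h1, h2⟩ => ⟨⟨(h.mp h1).1, h2⟩, fun h3 => (h.mp h1).2 h3.1⟩,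
      fun ⟨h1, h2⟩ => ⟨h.mpr ⟨h1.1, fun h3 => h2 ⟨h3, hs h1.2⟩⟩, h1.2⟩⟩
  le_refl i := ⟨P.le_refl i, fun _ _ => Iff.rfl⟩
  le_trans i j k h h' := ⟨P.le_trans i j k h.1 h'.1, fun F hF => (h.2 F hF).trans (h'.2 F hF)⟩
  le_antisymm i j h h' := P.le_antisymm i j h.1 h'.1

end PosetCone

end

/-!
Both sides are expanded over words `w : Fin n → ℕ+`, the integer points of the positive orthant.

The weight `w` is bounded above on the poset cone `C(P)` exactly when it is weakly increasing along
`P`, and it is then maximal exactly on the face generated by the `e_i - e_j` with `i <_P j` and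
`w i = w j`. Since the relative interior of the normal cone at a face consists of the weights that
are maximal exactly there (`mem_intrinsicInterior_normalCone_iff`), `F_q(C(P))` is the sum of
`q ^ dim · x_{w₁} ⋯ x_{w_n}` over the order preserving words
(`weightedEnumerator_relCone`). The weight of a word depends only on the relative order of its
letters, hence the series is quasisymmetric (`wordSeries_mem_QSym`) and is a combination of the
`M_α` indexed by packed words, those with set of letters `{1, …, k}`.

The antipode of `M_α` is `(-1)^k ∑_{v₁ ≥ ⋯ ≥ v_k} x_{v₁}^{α₁} ⋯ x_{v_k}^{α_k}`
(`coeff_antipodeM`): this series satisfies the recursion that defines the antipode, because the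
factorizations of a word into a weakly decreasing prefix and a strictly increasing suffix cancel in
pairs (`sum_chain_splits`). Consequently the coefficient of a word `u` in `S(F_q(C(P)))` is the
signed sum of the weights of the packed words `w` along which `u` weakly decreases
(`coeff_antipode_wordSeries`). If there is such an order preserving `w`, then `u` is order
reversing.

For an order reversing `u`, let `P_u` be the restriction of `P` to the level sets of `u`. The words
`w` in question are sorted by the face `G` of `C(P_u)` on which they are maximal. Those belonging to
a given `G` are the strictly order preserving surjections onto `{1, …, k}` from an acyclic relation
on the set of connected components determined by `G`, and their sum with signs `(-1)^k` is
`(-1)^(n - dim G)`. This is the reciprocity `sum_strictPackings`, proved by removing the block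
`w⁻¹(1)`, together with the formula `dim_relCone_add_card` for the dimension of a face.
So the coefficient of `u` is `(-1)^n f(C(P_u), -q)` (`sum_packedWords_wordWeight`). Finally, `u`
lies in the open braid cone of the opposite of exactly one flag, that of its upper level sets; this
is a flag of ideals of `P` if and only if `u` is order reversing, and its quotient poset is `P_u`.
-/

noncomputable section

/-! ### The antipode on the monomial basis -/

namespace QuasiSymm

variable {R : Type*} [CommRing R]

/-- The sum of `f` over all ways to decorate the parts of the composition `α` with variables from
the finite set `V`. A decorated composition is a list of pairs (variable, exponent). -/
def wordSum {A : Type*} [AddCommMonoid A] (V : Finset ℕ+) :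
    List ℕ+ → (List (ℕ+ × ℕ+) → A) → A
  | [], f => f []
  | a :: α, f => ∑ v ∈ V, wordSum V α fun l => f ((v, a) :: l)

/-- The exponent vector of the monomial `∏ x_v ^ a` over the entries `(v, a)` of a list. -/
def expo : List (ℕ+ × ℕ+) → (ℕ+ →₀ ℕ)
  | [] => 0
  | p :: l => Finsupp.single p.1 (p.2 : ℕ) + expo l

theorem expo_append (l l' : List (ℕ+ × ℕ+)) : expo (l ++ l') = expo l + expo l' := by
  induction l with
  | nil => simp [expo]
  | cons p l ih => simp [expo, ih, add_assoc]

theorem mem_support_expo {l : List (ℕ+ × ℕ+)} {i : ℕ+} :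
    i ∈ (expo l).support ↔ ∃ p ∈ l, p.1 = i := by
  induction l with
  | nil => simp [expo]
  | cons p l ih =>
    rw [List.exists_mem_cons_iff, ← ih]
    simp only [expo, Finsupp.mem_support_iff, Finsupp.add_apply, Finsupp.single_apply]
    have := p.2.pos
    split_ifs with h <;> simp [h]

section wordSum

variable {A : Type*} [AddCommMonoid A] {V : Finset ℕ+}

theorem wordSum_congr {α : List ℕ+} : ∀ {f g : List (ℕ+ × ℕ+) → A},
    (∀ l, l.map Prod.snd = α → f l = g l) → wordSum V α f = wordSum V α g := by
  induction α with
  | nil => intro f g h; exact h [] rfl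
  | cons a α ih =>
    intro f g h
    exact Finset.sum_congr rfl fun v _ => ih fun l hl => h _ (by simp [hl])

theorem wordSum_zero (α : List ℕ+) : wordSum V α (fun _ => (0 : A)) = 0 := by
  induction α with
  | nil => rfl
  | cons a α ih => simp [wordSum, ih]

theorem map_wordSum {B : Type*} [AddCommMonoid B] (φ : A →+ B) (α : List ℕ+) :
    ∀ f : List (ℕ+ × ℕ+) → A, φ (wordSum V α f) = wordSum V α fun l => φ (f l) := by
  induction α with
  | nil => intro f; rfl
  | cons a α ih => intro f; simp [wordSum, ih]

theorem wordSum_sum {ι : Type*} (s : Finset ι) (α : List ℕ+) :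
    ∀ f : ι → List (ℕ+ × ℕ+) → A,
      wordSum V α (fun l => ∑ i ∈ s, f i l) = ∑ i ∈ s, wordSum V α (f i) := by
  induction α with
  | nil => intro f; rfl
  | cons a α ih =>
    intro f
    simp only [wordSum, ih]
    rw [Finset.sum_comm]

theorem wordSum_take_drop (α : List ℕ+) :
    ∀ (i : ℕ) (f : List (ℕ+ × ℕ+) → List (ℕ+ × ℕ+) → A),
      wordSum V (α.take i) (fun l => wordSum V (α.drop i) fun l' => f l l') =
        wordSum V α fun l => f (l.take i) (l.drop i) := by
  induction α with
  | nil => intro i f; simp [wordSum]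
  | cons a α ih =>
    intro i f
    cases i with
    | zero => simp [wordSum]
    | succ i => simp [wordSum, ih]

end wordSum

theorem wordSum_mul {A : Type*} [CommRing A] {V : Finset ℕ+} (α : List ℕ+) (i : ℕ)
    (f g : List (ℕ+ × ℕ+) → A) :
    wordSum V (α.take i) f * wordSum V (α.drop i) g =
      wordSum V α fun l => f (l.take i) * g (l.drop i) := by
  rw [← wordSum_take_drop α i fun l l' => f l * g l']
  have h1 := map_wordSum (V := V) (AddMonoidHom.mulRight (wordSum V (α.drop i) g)) (α.take i) f
  simp only [AddMonoidHom.coe_mulRight] at h1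
  rw [h1]
  refine wordSum_congr fun l _ => ?_
  exact map_wordSum (AddMonoidHom.mulLeft (f l)) (α.drop i) g

open Classical in
/-- The cancellation behind the antipode: a nonempty word has as many factorizations into a weakly
decreasing prefix of even length and a strictly increasing suffix as with a prefix of odd
length. -/
theorem sum_chain_splits (l : List (ℕ+ × ℕ+)) :
    ∑ i ∈ Finset.range (l.length + 1), (-1 : R) ^ i *
      ((if (l.take i).IsChain (fun p q => q.1 ≤ p.1) then 1 else 0) *
        (if (l.drop i).IsChain (fun p q => p.1 < q.1) then 1 else 0)) =
      if l = [] then 1 else 0 := by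
  induction l with
  | nil => simp
  | cons a l ih =>
    cases l with
    | nil => simp [Finset.sum_range_succ]
    | cons b l =>
      rw [Finset.sum_range_succ'] at ih ⊢
      rw [List.length_cons, Finset.sum_range_succ']
      simp only [List.take_succ_cons, List.drop_succ_cons, List.take_zero, List.drop_zero,
        List.isChain_cons_cons, List.IsChain.nil, List.IsChain.singleton, if_true, one_mul,
        pow_zero, if_neg (List.cons_ne_nil _ _), zero_add, pow_succ] at ih ⊢
      rcases le_or_gt b.1 a.1 with h | h
      · simp only [h, h.not_gt, true_and, false_and, if_false, add_zero]
        have := congrArg Neg.neg ih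
        rw [neg_add, ← Finset.sum_neg_distrib, neg_zero] at this
        convert this using 2
        · exact Finset.sum_congr rfl fun i _ => by split_ifs <;> simp_all
        · split_ifs <;> simp
      · simp only [h, h.not_ge, true_and, false_and, if_false, zero_mul, mul_zero,
          Finset.sum_const_zero, zero_add, List.length_cons]
        split_ifs <;> simp

open Classical in
/-- The part of `M_α` in the variables `x_v`, `v ∈ V`. -/
def strictSeries (R : Type*) [CommRing R] (V : Finset ℕ+) (α : List ℕ+) : MvPowerSeries ℕ+ R :=
  wordSum V α fun l =>
    if l.IsChain (fun p q => p.1 < q.1) then MvPowerSeries.monomial (expo l) 1 else 0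

open Classical in
/-- The sum of the monomials `x_{v₁}^{α₁} ⋯ x_{v_k}^{α_k}` over all `v₁ ≥ ⋯ ≥ v_k` in `V`. -/
def weakSeries (R : Type*) [CommRing R] (V : Finset ℕ+) (α : List ℕ+) : MvPowerSeries ℕ+ R :=
  wordSum V α fun l =>
    if l.IsChain (fun p q => q.1 ≤ p.1) then MvPowerSeries.monomial (expo l) 1 else 0

theorem sum_weakSeries_mul_strictSeries (V : Finset ℕ+) (α : List ℕ+) (hα : α ≠ []) :
    ∑ i ∈ Finset.range (α.length + 1),
      (-1 : MvPowerSeries ℕ+ R) ^ i * (weakSeries R V (α.take i) * strictSeries R V (α.drop i)) =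
      0 := by
  classical
  have h1 : ∀ i, (-1 : MvPowerSeries ℕ+ R) ^ i *
      (weakSeries R V (α.take i) * strictSeries R V (α.drop i)) =
      wordSum V α fun l => (-1) ^ i *
      ((if (l.take i).IsChain (fun p q => q.1 ≤ p.1) then 1 else 0) *
        (if (l.drop i).IsChain (fun p q => p.1 < q.1) then 1 else 0)) *
      MvPowerSeries.monomial (expo l) 1 := by
    intro i
    rw [weakSeries, strictSeries, wordSum_mul]
    refine (map_wordSum (AddMonoidHom.mulLeft ((-1 : MvPowerSeries ℕ+ R) ^ i)) α _).trans
      (wordSum_congr fun l _ => ?_)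
    have : MvPowerSeries.monomial (R := R) (expo l) 1 =
        MvPowerSeries.monomial (expo (l.take i)) 1 * MvPowerSeries.monomial (expo (l.drop i)) 1 := by
      rw [MvPowerSeries.monomial_mul_monomial, ← expo_append, List.take_append_drop, one_mul]
    rw [this]
    simp only [AddMonoidHom.coe_mulLeft]
    split_ifs <;> simp
  rw [Finset.sum_congr rfl fun i _ => h1 i, ← wordSum_sum]
  refine (wordSum_congr fun l hl => ?_).trans (wordSum_zero α)
  rw [← Finset.sum_mul]
  have hlen : α.length = l.length := by rw [← hl, List.length_map]
  rw [hlen, sum_chain_splits, if_neg, zero_mul]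
  rintro rfl
  exact hα hl.symm

theorem isChain_lt_cons_iff {p : ℕ+ × ℕ+} {l : List (ℕ+ × ℕ+)} :
    (p :: l).IsChain (fun p q => p.1 < q.1) ↔
      (∀ i ∈ (expo l).support, p.1 < i) ∧ l.IsChain (fun p q => p.1 < q.1) := by
  have : IsTrans (ℕ+ × ℕ+) (fun p q => p.1 < q.1) := ⟨fun _ _ _ h h' => lt_trans h h'⟩
  rw [List.isChain_iff_pairwise, List.isChain_iff_pairwise, List.pairwise_cons]
  simp only [mem_support_expo]
  grind

/-- On monomials in the variables from `V`, the truncated series agrees with `M_α`. -/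
theorem coeff_strictSeries (V : Finset ℕ+) (m : ℕ+ →₀ ℕ) : ∀ (α : List ℕ+), m.support ⊆ V →
    MvPowerSeries.coeff m (strictSeries R V α) = if shape m = α then 1 else 0 := by
  classical
  have expand : ∀ (m : ℕ+ →₀ ℕ) α, MvPowerSeries.coeff m (strictSeries R V α) =
      wordSum V α fun l => if l.IsChain (fun p q => p.1 < q.1) ∧ expo l = m then (1 : R) else 0 := by
    intro m α
    refine (map_wordSum (MvPowerSeries.coeff m).toAddMonoidHom α _).trans
      (wordSum_congr fun l _ => ?_)
    simp only [LinearMap.toAddMonoidHom_coe]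
    split_ifs with h1 h2 h2
    · rw [← h2.2, MvPowerSeries.coeff_monomial_same]
    · rw [MvPowerSeries.coeff_monomial_ne]
      exact fun h => h2 ⟨h1, h.symm⟩
    · exact absurd h2.1 h1
    · simp
  induction m using Finsupp.induction_on_min with
  | zero =>
    intro α _
    rw [expand]
    cases α with
    | nil => simp [wordSum, expo]
    | cons a α =>
      rw [if_neg (by simp)]
      refine (wordSum_congr fun l hl => if_neg fun h => ?_).trans (wordSum_zero (a :: α))
      cases l with
      | nil => simp at hl
      | cons p l =>
        have := DFunLike.congr_fun h.2 p.1
        simp [expo] at this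
  | single_add i b m hm hb ih =>
    intro α hV
    have hi : i ∉ m.support := fun hh => lt_irrefl _ (hm i hh)
    have hs : (Finsupp.single i b + m).support = Finset.cons i m.support hi :=
      Finsupp.support_single_add hi hb
    have hmi : m i = 0 := Finsupp.notMem_support_iff.mp hi
    rw [hs, Finset.cons_eq_insert, Finset.insert_subset_iff] at hV
    rw [shape_single_add i b m hm, consPart, if_neg hb, expand]
    cases α with
    | nil =>
      rw [if_neg (by simp), wordSum, if_neg]
      intro h
      have := DFunLike.congr_fun h.2 i
      simp [expo, hb.symm, hmi] at this
    | cons a α =>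
      have ih' := ih α hV.2
      rw [expand] at ih'
      -- the smallest variable of a strictly increasing word is that of its first letter
      have key : ∀ v l, (((v, a) :: l).IsChain (fun p q => p.1 < q.1) ∧
          expo ((v, a) :: l) = Finsupp.single i b + m) ↔
          v = i ∧ (a : ℕ) = b ∧ (l.IsChain (fun p q => p.1 < q.1) ∧ expo l = m) := by
        intro v l
        rw [isChain_lt_cons_iff]
        constructor
        · rintro ⟨⟨h1, h2⟩, h3⟩
          have hvn : v ∉ (expo l).support := fun hh => lt_irrefl _ (h1 v hh)
          have hsup : Finset.cons v (expo l).support hvn = Finset.cons i m.support hi := by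
            rw [← hs, ← h3, expo, Finsupp.support_single_add hvn a.pos.ne']
          have hvi : v = i := by
            have e1 : v ∈ Finset.cons i m.support hi := hsup ▸ Finset.mem_cons_self _ _
            have e2 : i ∈ Finset.cons v (expo l).support hvn := hsup ▸ Finset.mem_cons_self _ _
            rcases Finset.mem_cons.mp e1 with e1 | e1
            · exact e1
            rcases Finset.mem_cons.mp e2 with e2 | e2
            · exact e2.symm
            · exact absurd (hm _ e1) (h1 _ e2).not_gt
          subst hvi
          have hab : (a : ℕ) = b := by
            have := DFunLike.congr_fun h3 v
            simpa [expo, hmi, Finsupp.notMem_support_iff.mp hvn] using this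
          refine ⟨rfl, hab, h2, ?_⟩
          rw [expo, hab] at h3
          exact add_left_cancel h3
        · rintro ⟨rfl, h1, h2, rfl⟩
          exact ⟨⟨hm, h2⟩, by rw [expo, h1]⟩
      simp only [wordSum, key]
      rw [Finset.sum_eq_single i]
      · by_cases hab : (a : ℕ) = b
        · subst hab
          simp only [true_and, ih']
          simp
        · have : b.toPNat' ≠ a := by
            rintro rfl
            exact hab (by simp [Nat.toPNat'_coe, Nat.pos_of_ne_zero hb])
          simp [hab, this, wordSum_zero]
      · intro v _ hv
        simp [hv, wordSum_zero]
      · exact fun h => absurd hV.1 h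

/-- Congruence of products: coefficients at monomials in the variables of `V` only involve such
monomials of the factors. -/
theorem coeff_mul_congr {V : Finset ℕ+} {f f' g g' : MvPowerSeries ℕ+ R}
    (hf : ∀ m : ℕ+ →₀ ℕ, m.support ⊆ V → MvPowerSeries.coeff m f = MvPowerSeries.coeff m f')
    (hg : ∀ m : ℕ+ →₀ ℕ, m.support ⊆ V → MvPowerSeries.coeff m g = MvPowerSeries.coeff m g')
    (m : ℕ+ →₀ ℕ) (hm : m.support ⊆ V) :
    MvPowerSeries.coeff m (f * g) = MvPowerSeries.coeff m (f' * g') := by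
  classical
  rw [MvPowerSeries.coeff_mul, MvPowerSeries.coeff_mul]
  refine Finset.sum_congr rfl fun p hp => ?_
  rw [Finset.HasAntidiagonal.mem_antidiagonal] at hp
  have h1 : p.1.support ⊆ V := (Finsupp.support_mono (by rw [← hp]; exact le_self_add)).trans hm
  have h2 : p.2.support ⊆ V := (Finsupp.support_mono (by rw [← hp]; exact le_add_self)).trans hm
  rw [hf _ h1, hg _ h2]

/-- The antipode of `M_α` is `(-1)^k ∑_{v₁ ≥ ⋯ ≥ v_k} x_{v₁}^{α₁} ⋯ x_{v_k}^{α_k}`, stated in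
finitely many variables. -/
theorem coeff_antipodeM (V : Finset ℕ+) (α : List ℕ+) : ∀ m : ℕ+ →₀ ℕ, m.support ⊆ V →
    MvPowerSeries.coeff m (antipodeM R α : MvPowerSeries ℕ+ R) =
      MvPowerSeries.coeff m ((-1) ^ α.length * weakSeries R V α) := by
  induction h : α.length using Nat.strong_induction_on generalizing α with
  | _ k ih =>
    subst h
    intro m hm
    rw [antipodeM]
    rcases eq_or_ne α [] with rfl | hα
    · simp [weakSeries, wordSum, expo, MvPowerSeries.monomial_zero_one]
    rw [if_neg hα]
    have hsum := sum_weakSeries_mul_strictSeries (R := R) V α hα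
    rw [Finset.sum_range_succ, List.take_length, List.drop_length] at hsum
    have hnil : strictSeries R V [] = 1 := by
      simp [strictSeries, wordSum, expo, MvPowerSeries.monomial_zero_one]
    rw [hnil, mul_one, add_comm] at hsum
    rw [eq_neg_of_add_eq_zero_left hsum]
    have hc : ((-∑ i : Fin α.length, antipodeM R (α.take i) * M R (α.drop i) : QSym R) :
        MvPowerSeries ℕ+ R) = -∑ i : Fin α.length,
          (antipodeM R (α.take i) : MvPowerSeries ℕ+ R) * (M R (α.drop i) : MvPowerSeries ℕ+ R) := by
      simp
    rw [hc, map_neg, map_neg, map_sum, map_sum, Finset.sum_range]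
    congr 1
    refine Finset.sum_congr rfl fun i _ => ?_
    rw [← mul_assoc]
    refine coeff_mul_congr (V := V) (fun m' hm' => ?_) (fun m' hm' => ?_) m hm
    · have hl : (α.take i).length = i := by simp
      rw [ih i i.2 (α.take i) hl m' hm']
    · rw [coeff_strictSeries V m' _ hm']
      simp [M]

end QuasiSymm

/-! ### Relabelling monomials -/

namespace QuasiSymm

variable {R : Type*} [CommRing R]

theorem ext_support_shape {m m' : ℕ+ →₀ ℕ} (hs : m.support = m'.support)
    (h : shape m = shape m') : m = m' := by
  unfold shape at h
  rw [hs, List.map_inj_left] at h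
  ext i
  by_cases hi : i ∈ m'.support
  · have h1 := congrArg PNat.val (h i ((Finset.mem_sort _).mpr hi))
    have h2 : m i ≠ 0 := Finsupp.mem_support_iff.mp (hs ▸ hi)
    have h3 : m' i ≠ 0 := Finsupp.mem_support_iff.mp hi
    change ((m i).toPNat' : ℕ) = ((m' i).toPNat' : ℕ) at h1
    rwa [Nat.toPNat'_coe, Nat.toPNat'_coe, if_pos (Nat.pos_of_ne_zero h2),
      if_pos (Nat.pos_of_ne_zero h3)] at h1
  · rw [Finsupp.notMem_support_iff.mp hi, Finsupp.notMem_support_iff.mp (hs ▸ hi)]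

theorem length_shape (m : ℕ+ →₀ ℕ) : (shape m).length = m.support.card := by
  simp [shape]

theorem support_mapDomain_eq_image (φ : ℕ+ → ℕ+) (m : ℕ+ →₀ ℕ) :
    (m.mapDomain φ).support = m.support.image φ := by
  induction m using Finsupp.induction_on_min with
  | zero => simp
  | single_add i a m h ha ih =>
    have hi : i ∉ m.support := fun hh => lt_irrefl _ (h i hh)
    rw [Finsupp.support_single_add hi ha, Finsupp.mapDomain_add, Finsupp.mapDomain_single,
      Finset.cons_eq_insert, Finset.image_insert, ← ih]
    ext j
    simp only [Finsupp.mem_support_iff, Finsupp.add_apply, Finset.mem_insert,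
      Finsupp.single_apply]
    split_ifs with hj
    · simp [hj, ha]
    · simp [Ne.symm hj]

theorem shape_mapDomain {φ : ℕ+ → ℕ+} (m : ℕ+ →₀ ℕ) (hφ : StrictMonoOn φ m.support) :
    shape (m.mapDomain φ) = shape m := by
  induction m using Finsupp.induction_on_min with
  | zero => simp
  | single_add i a m h ha ih =>
    have hi : i ∉ m.support := fun hh => lt_irrefl _ (h i hh)
    have hs := Finsupp.support_single_add hi ha
    rw [hs, Finset.cons_eq_insert, Finset.coe_insert] at hφ
    rw [Finsupp.mapDomain_add, Finsupp.mapDomain_single, shape_single_add i a m h,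
      shape_single_add, ih (hφ.mono (Set.subset_insert _ _))]
    intro j hj
    rw [support_mapDomain_eq_image] at hj
    obtain ⟨b, hb, rfl⟩ := Finset.mem_image.mp hj
    exact hφ (Set.mem_insert _ _) (Set.mem_insert_of_mem _ hb) (h b hb)

theorem exists_strictMonoOn_image_eq {s t : Finset ℕ+} (h : s.card = t.card) :
    ∃ φ : ℕ+ → ℕ+, StrictMonoOn φ s ∧ s.image φ = t := by
  classical
  let e : s ≃o t := (s.orderIsoOfFin rfl).symm.trans (t.orderIsoOfFin h.symm)
  refine ⟨fun a => if ha : a ∈ s then e ⟨a, ha⟩ else 1, ?_, ?_⟩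
  · intro a ha b hb hab
    have ha' : a ∈ s := ha
    have hb' : b ∈ s := hb
    simp only [ha', hb', dif_pos]
    exact e.strictMono (Subtype.mk_lt_mk.mpr hab)
  · ext b
    simp only [Finset.mem_image]
    constructor
    · rintro ⟨a, ha, rfl⟩
      simp [ha]
    · intro hb
      refine ⟨e.symm ⟨b, hb⟩, (e.symm ⟨b, hb⟩).2, ?_⟩
      simp

/-- Monomials of the same shape differ by an increasing relabelling of the variables. -/
theorem exists_mapDomain_eq_of_shape_eq {m m' : ℕ+ →₀ ℕ} (h : shape m = shape m') :
    ∃ φ : ℕ+ → ℕ+, StrictMonoOn φ m.support ∧ m.mapDomain φ = m' := by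
  obtain ⟨φ, hφ, himg⟩ := exists_strictMonoOn_image_eq (s := m.support) (t := m'.support)
    (by rw [← length_shape, ← length_shape, h])
  exact ⟨φ, hφ, ext_support_shape (by rw [support_mapDomain_eq_image, himg])
    (by rw [shape_mapDomain m hφ, h])⟩

theorem mem_support_stdExp (α : List ℕ+) : ∀ (c i : ℕ+),
    i ∈ (stdExp c α).support ↔ c ≤ i ∧ (i : ℕ) < c + α.length := by
  induction α with
  | nil => intro c i; simp [stdExp, ← PNat.coe_le_coe]
  | cons a α ih =>
    intro c i
    have hc : c ∉ (stdExp (c + 1) α).support := fun h =>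
      (PNat.lt_add_right c 1).not_ge (le_of_mem_stdExp α _ c h)
    rw [stdExp, Finsupp.support_single_add hc a.pos.ne', Finset.mem_cons, ih]
    simp only [← PNat.coe_le_coe, ← PNat.coe_inj, PNat.add_coe, List.length_cons, PNat.one_coe]
    omega

/-! ### Enumerators of words -/

variable {n : ℕ}

/-- The exponent vector of the monomial `x_{w₁} ⋯ x_{w_n}`. -/
def monoExp (w : Fin n → ℕ+) : ℕ+ →₀ ℕ := ∑ i, Finsupp.single (w i) 1

theorem monoExp_apply (w : Fin n → ℕ+) (a : ℕ+) :
    monoExp w a = (Finset.univ.filter fun i => w i = a).card := by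
  simp [monoExp, Finsupp.finsetSum_apply, Finsupp.single_apply]

theorem support_monoExp (w : Fin n → ℕ+) : (monoExp w).support = Finset.univ.image w := by
  ext a
  rw [Finsupp.mem_support_iff, monoExp_apply, ← Nat.pos_iff_ne_zero, Finset.card_pos]
  simp [Finset.Nonempty]

theorem mapDomain_monoExp (φ : ℕ+ → ℕ+) (w : Fin n → ℕ+) :
    (monoExp w).mapDomain φ = monoExp (φ ∘ w) := by
  simp [monoExp, Finsupp.mapDomain_finsetSum, Finsupp.mapDomain_single]

theorem degree_monoExp (w : Fin n → ℕ+) : (monoExp w).degree = n := by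
  simp [monoExp, map_sum, Finsupp.degree_single]

/-- The words `w` with `x_{w₁} ⋯ x_{w_n} = x^m`. -/
def words (n : ℕ) (m : ℕ+ →₀ ℕ) : Finset (Fin n → ℕ+) :=
  (Fintype.piFinset fun _ => m.support).filter fun w => monoExp w = m

@[simp] theorem mem_words {m : ℕ+ →₀ ℕ} {w : Fin n → ℕ+} : w ∈ words n m ↔ monoExp w = m := by
  rw [words, Finset.mem_filter, and_iff_right_iff_imp]
  rintro rfl
  simp [support_monoExp]

/-- The series `∑_w c(w) x_{w₁} ⋯ x_{w_n}`. -/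
def wordSeries (c : (Fin n → ℕ+) → R) : MvPowerSeries ℕ+ R :=
  ofCoeff fun m => ∑ w ∈ words n m, c w

/-- A weight on words is order invariant if it does not change under increasing relabellings. -/
def OrderInvariant (c : (Fin n → ℕ+) → R) : Prop :=
  ∀ (w : Fin n → ℕ+) (φ : ℕ+ → ℕ+), StrictMonoOn φ (Set.range w) → c (φ ∘ w) = c w

theorem wordSeries_mem_QSym {c : (Fin n → ℕ+) → R} (hc : OrderInvariant c) :
    wordSeries c ∈ QSym R := by
  refine ⟨fun m m' h => ?_, n, fun m hm => ?_⟩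
  · obtain ⟨φ, hφ, rfl⟩ := exists_mapDomain_eq_of_shape_eq h
    rw [wordSeries, coeff_ofCoeff, coeff_ofCoeff]
    have hsub : ∀ w ∈ words n m, Set.range w ⊆ m.support := by
      intro w hw
      rw [← mem_words.mp hw, support_monoExp]
      simp
    refine Finset.sum_bij (fun w _ => φ ∘ w) ?_ ?_ ?_ ?_
    · intro w hw
      rw [mem_words, ← mapDomain_monoExp, mem_words.mp hw]
    · intro w hw w' hw' hww
      funext i
      exact hφ.injOn (hsub w hw ⟨i, rfl⟩) (hsub w' hw' ⟨i, rfl⟩) (congrFun hww i)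
    · intro w' hw'
      have : ∀ i, ∃ a ∈ m.support, φ a = w' i := by
        intro i
        rw [← Finset.mem_image, ← support_mapDomain_eq_image, ← mem_words.mp hw', support_monoExp]
        exact Finset.mem_image_of_mem _ (Finset.mem_univ _)
      choose w hw hφw using this
      have hw'' : φ ∘ w = w' := funext hφw
      refine ⟨w, ?_, hw''⟩
      rw [mem_words]
      refine Finsupp.mapDomain_injOn (S := (m.support : Set ℕ+)) hφ.injOn ?_
        (subset_rfl : (m.support : Set ℕ+) ⊆ m.support) ?_
      · change ((monoExp w).support : Set ℕ+) ⊆ _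
        rw [support_monoExp]
        intro a ha
        simp only [Finset.coe_image, Finset.coe_univ, Set.image_univ, Set.mem_range] at ha
        obtain ⟨i, rfl⟩ := ha
        exact hw i
      · rw [mapDomain_monoExp, hw'', mem_words.mp hw']
    · intro w hw
      exact (hc w φ (hφ.mono (hsub w hw))).symm
  · rw [wordSeries, coeff_ofCoeff]
    refine Finset.sum_eq_zero fun w hw => ?_
    rw [← mem_words.mp hw, degree_monoExp] at hm
    exact absurd hm (lt_irrefl _)

/-- A word is packed if its letters are `1, …, k` for some `k`. -/
def IsPacked (w : Fin n → ℕ+) : Prop := ∀ i, ∀ a ≤ w i, ∃ j, w j = a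

theorem IsPacked.mem_image_iff {w : Fin n → ℕ+} (hw : IsPacked w) (a : ℕ+) :
    a ∈ Finset.univ.image w ↔ (a : ℕ) ≤ (Finset.univ.image w).card := by
  constructor
  · intro ha
    obtain ⟨i, -, rfl⟩ := Finset.mem_image.mp ha
    have : Finset.Icc 1 (w i) ⊆ Finset.univ.image w := fun b hb => by
      obtain ⟨j, hj⟩ := hw i b (Finset.mem_Icc.mp hb).2
      exact Finset.mem_image.mpr ⟨j, Finset.mem_univ _, hj⟩
    simpa using Finset.card_le_card this
  · intro ha
    by_contra hna
    have : Finset.univ.image w ⊆ Finset.Ico 1 a := fun b hb => by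
      obtain ⟨i, -, rfl⟩ := Finset.mem_image.mp hb
      refine Finset.mem_Ico.mpr ⟨one_le, ?_⟩
      by_contra hle
      obtain ⟨j, hj⟩ := hw i a (not_lt.mp hle)
      exact hna (Finset.mem_image.mpr ⟨j, Finset.mem_univ _, hj⟩)
    have h2 := Finset.card_le_card this
    rw [PNat.card_Ico] at h2
    have := a.pos
    simp only [PNat.one_coe] at h2
    omega

theorem isPacked_iff (w : Fin n → ℕ+) :
    IsPacked w ↔ monoExp w = stdExp 1 (shape (monoExp w)) := by
  constructor
  · intro hw
    refine ext_support_shape ?_ (by simp)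
    ext a
    rw [mem_support_stdExp, length_shape, support_monoExp, hw.mem_image_iff]
    simp only [one_le, true_and, PNat.one_coe]
    omega
  · intro h i a ha
    have key : ∀ b, (∃ j, w j = b) ↔ b ∈ (stdExp 1 (shape (monoExp w))).support := by
      intro b
      rw [← h, support_monoExp]
      simp
    rw [key]
    have := (key (w i)).mp ⟨i, rfl⟩
    rw [mem_support_stdExp] at this ⊢
    exact ⟨one_le, lt_of_le_of_lt (PNat.coe_le_coe _ _ |>.mpr ha) this.2⟩

open Classical in
/-- The set of packed words of length `n`. -/
def packedWords (n : ℕ) : Finset (Fin n → ℕ+) :=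
  (Fintype.piFinset fun _ => Finset.Icc 1 n.succPNat).filter IsPacked

@[simp] theorem mem_packedWords {w : Fin n → ℕ+} : w ∈ packedWords n ↔ IsPacked w := by
  classical
  rw [packedWords, Finset.mem_filter, and_iff_right_iff_imp]
  intro hw
  simp only [Fintype.mem_piFinset, Finset.mem_Icc, one_le, true_and]
  intro i
  have h1 := (hw.mem_image_iff (w i)).mp (Finset.mem_image_of_mem _ (Finset.mem_univ _))
  have h2 : (Finset.univ.image w).card ≤ n := Finset.card_image_le.trans (by simp)
  rw [← PNat.coe_le_coe, Nat.succPNat_coe]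
  omega

theorem wordSeries_eq_sum_M {c : (Fin n → ℕ+) → R} (hc : OrderInvariant c) :
    (⟨wordSeries c, wordSeries_mem_QSym hc⟩ : QSym R) =
      ∑ w ∈ packedWords n, c w • M R (shape (monoExp w)) := by
  classical
  refine ext_mcoeff fun β => ?_
  rw [← mcoeffL_apply β (Finset.sum _ _), map_sum]
  simp only [map_smul, mcoeffL_apply, mcoeff_M, smul_eq_mul, mul_ite, mul_one, mul_zero]
  rw [← Finset.sum_filter]
  change ∑ w ∈ words n (stdExp 1 β), c w = _
  refine Finset.sum_congr ?_ fun _ _ => rfl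
  ext w
  rw [mem_words, Finset.mem_filter, mem_packedWords, isPacked_iff]
  constructor
  · intro h
    simp [h]
  · rintro ⟨h1, rfl⟩
    exact h1

/-! ### Weakly decreasing words -/

/-- The decoration of `α` by the variables `φ(c), φ(c+1), …`. -/
def decorate (φ : ℕ+ → ℕ+) : ℕ+ → List ℕ+ → List (ℕ+ × ℕ+)
  | _, [] => []
  | c, a :: α => (φ c, a) :: decorate φ (c + 1) α

theorem expo_decorate (φ : ℕ+ → ℕ+) (α : List ℕ+) : ∀ c,
    expo (decorate φ c α) = (stdExp c α).mapDomain φ := by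
  induction α with
  | nil => intro c; simp [decorate, expo, stdExp]
  | cons a α ih =>
    intro c
    rw [decorate, expo, ih, stdExp, Finsupp.mapDomain_add, Finsupp.mapDomain_single]

theorem map_snd_decorate (φ : ℕ+ → ℕ+) (α : List ℕ+) : ∀ c,
    (decorate φ c α).map Prod.snd = α := by
  induction α with
  | nil => intro c; rfl
  | cons a α ih => intro c; simp [decorate, ih]

theorem mem_support_stdExp_cons (a : ℕ+) (α : List ℕ+) (c i : ℕ+) :
    i ∈ (stdExp c (a :: α)).support ↔ i = c ∨ i ∈ (stdExp (c + 1) α).support := by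
  rw [mem_support_stdExp, mem_support_stdExp]
  simp only [← PNat.coe_le_coe, ← PNat.coe_inj, PNat.add_coe, List.length_cons, PNat.one_coe]
  omega

theorem decorate_inj {φ ψ : ℕ+ → ℕ+} (α : List ℕ+) : ∀ c,
    decorate φ c α = decorate ψ c α ↔ ∀ i ∈ (stdExp c α).support, φ i = ψ i := by
  induction α with
  | nil => intro c; simp [decorate, stdExp]
  | cons a α ih =>
    intro c
    simp only [decorate, List.cons.injEq, Prod.mk.injEq, and_true, ih, mem_support_stdExp_cons,
      forall_eq_or_imp]

theorem mem_decorate_fst {φ : ℕ+ → ℕ+} (α : List ℕ+) : ∀ (c : ℕ+) (b : ℕ+),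
    (∃ p ∈ decorate φ c α, p.1 = b) ↔ ∃ i ∈ (stdExp c α).support, φ i = b := by
  induction α with
  | nil => intro c b; simp [decorate, stdExp]
  | cons a α ih =>
    intro c b
    simp only [decorate, List.exists_mem_cons_iff, ih, mem_support_stdExp_cons,
      exists_eq_or_imp]

theorem isChain_decorate {φ : ℕ+ → ℕ+} (α : List ℕ+) : ∀ c,
    (decorate φ c α).IsChain (fun p q => q.1 ≤ p.1) ↔ AntitoneOn φ (stdExp c α).support := by
  have : IsTrans (ℕ+ × ℕ+) (fun p q => q.1 ≤ p.1) := ⟨fun _ _ _ h h' => le_trans h' h⟩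
  induction α with
  | nil => intro c; simp [decorate, stdExp, AntitoneOn]
  | cons a α ih =>
    intro c
    have ih' := ih (c + 1)
    rw [List.isChain_iff_pairwise] at ih' ⊢
    rw [decorate, List.pairwise_cons, ih']
    have hs : ((stdExp c (a :: α)).support : Set ℕ+) = insert c ((stdExp (c + 1) α).support : Set ℕ+) := by
      ext i
      simp only [Finset.mem_coe, Set.mem_insert_iff, mem_support_stdExp_cons]
    have hlt : ∀ i ∈ (stdExp (c + 1) α).support, c < i := fun i hi =>
      (PNat.lt_add_right c 1).trans_le (le_of_mem_stdExp α _ i hi)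
    rw [hs]
    constructor
    · rintro ⟨h1, h2⟩ i hi j hj hij
      rcases hi with rfl | hi <;> rcases hj with rfl | hj
      · exact le_rfl
      · obtain ⟨p, hp, hpj⟩ := (mem_decorate_fst α (i + 1) (φ j)).mpr ⟨j, hj, rfl⟩
        rw [← hpj]
        exact h1 p hp
      · exact absurd (hlt i hi) hij.not_gt
      · exact h2 hi hj hij
    · intro h
      refine ⟨fun p hp => ?_, h.mono (Set.subset_insert _ _)⟩
      obtain ⟨i, hi, hpi⟩ := (mem_decorate_fst α (c + 1) p.1).mp ⟨p, hp, rfl⟩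
      rw [← hpi]
      exact h (Set.mem_insert _ _) (Set.mem_insert_of_mem _ hi) (hlt i hi).le

theorem exists_decorate_eq : ∀ (l : List (ℕ+ × ℕ+)) (c : ℕ+),
    ∃ φ, l = decorate φ c (l.map Prod.snd) := by
  intro l
  induction l with
  | nil => intro c; exact ⟨id, rfl⟩
  | cons p l ih =>
    intro c
    obtain ⟨φ, hφ⟩ := ih (c + 1)
    refine ⟨Function.update φ c p.1, ?_⟩
    rw [List.map_cons, decorate, Function.update_self]
    congr 1
    conv_lhs => rw [hφ]
    rw [decorate_inj]
    intro i hi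
    rw [Function.update_of_ne]
    rintro rfl
    exact (PNat.lt_add_right i 1).not_ge (le_of_mem_stdExp _ _ i hi)

/-- All decorations of `α` by variables from `V`. -/
def decorations (V : Finset ℕ+) : List ℕ+ → Finset (List (ℕ+ × ℕ+))
  | [] => {[]}
  | a :: α => V.biUnion fun v => (decorations V α).image fun l => (v, a) :: l

theorem mem_decorations {V : Finset ℕ+} (α : List ℕ+) : ∀ (l : List (ℕ+ × ℕ+)),
    l ∈ decorations V α ↔ l.map Prod.snd = α ∧ (expo l).support ⊆ V := by
  induction α with
  | nil =>
    intro l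
    cases l <;> simp [decorations, expo]
  | cons a α ih =>
    intro l
    cases l with
    | nil => simp [decorations]
    | cons p l =>
      simp only [decorations, Finset.mem_biUnion, Finset.mem_image, ih]
      have : (expo (p :: l)).support ⊆ V ↔ p.1 ∈ V ∧ (expo l).support ⊆ V := by
        simp only [Finset.subset_iff, mem_support_expo]
        grind
      rw [this]
      grind

theorem wordSum_eq_sum {A : Type*} [AddCommMonoid A] {V : Finset ℕ+} (α : List ℕ+) :
    ∀ f : List (ℕ+ × ℕ+) → A, wordSum V α f = ∑ l ∈ decorations V α, f l := by
  induction α with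
  | nil => intro f; simp [wordSum, decorations]
  | cons a α ih =>
    intro f
    rw [wordSum, decorations, Finset.sum_biUnion]
    · refine Finset.sum_congr rfl fun v _ => ?_
      rw [Finset.sum_image (by intro x _ y _ h; simpa using h), ih]
    · intro v _ v' _ hne
      rw [Function.onFun, Finset.disjoint_left]
      intro l hl hl'
      simp only [Finset.mem_image] at hl hl'
      grind

open Classical in
/-- If `α` is the composition of block sizes of a packed word `w`, then the weakly decreasing
decorations of `α` correspond to the words `u` that weakly decrease along `w`. -/
theorem coeff_weakSeries {w : Fin n → ℕ+} (hw : IsPacked w) (m : ℕ+ →₀ ℕ) :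
    MvPowerSeries.coeff m (weakSeries R m.support (shape (monoExp w))) =
      (((words n m).filter fun u => ∀ i j, w i ≤ w j → u j ≤ u i).card : R) := by
  set α := shape (monoExp w) with hα
  have hwα : monoExp w = stdExp 1 α := (isPacked_iff w).mp hw
  have hsupp : ∀ a, a ∈ (stdExp 1 α).support ↔ ∃ i, w i = a := by
    intro a
    rw [← hwα, support_monoExp]
    simp
  have h1 : MvPowerSeries.coeff m (weakSeries R m.support α) =
      ∑ l ∈ (decorations m.support α).filter
        (fun l => l.IsChain (fun p q => q.1 ≤ p.1) ∧ expo l = m), (1 : R) := by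
    rw [Finset.sum_filter, weakSeries, wordSum_eq_sum, map_sum]
    refine Finset.sum_congr rfl fun l _ => ?_
    split_ifs with h1 h2 h2
    · rw [← h2.2, MvPowerSeries.coeff_monomial_same]
    · rw [MvPowerSeries.coeff_monomial_ne]
      exact fun h => h2 ⟨h1, h.symm⟩
    · exact absurd h2.1 h1
    · simp
  rw [h1, Finset.sum_const, nsmul_one]
  congr 1
  symm
  -- a word `u` that decreases along `w` factors through `w`; off the letters of `w` the value of the
  -- factor is irrelevant
  let ext : (Fin n → ℕ+) → ℕ+ → ℕ+ := fun u a => if h : ∃ i, w i = a then u h.choose else 1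
  have hext : ∀ u : Fin n → ℕ+, (∀ i j, w i ≤ w j → u j ≤ u i) → ∀ i, ext u (w i) = u i := by
    intro u hu i
    have h : ∃ j, w j = w i := ⟨i, rfl⟩
    simp only [ext, h, dif_pos]
    exact le_antisymm (hu _ _ h.choose_spec.ge) (hu _ _ h.choose_spec.le)
  refine Finset.card_bij (fun u _ => decorate (ext u) 1 α) ?_ ?_ ?_
  · intro u hu
    rw [Finset.mem_filter, mem_words] at hu
    have hexpo : expo (decorate (ext u) 1 α) = m := by
      rw [expo_decorate, ← hwα, mapDomain_monoExp, ← hu.1]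
      congr 1
      exact funext (hext u hu.2)
    rw [Finset.mem_filter, mem_decorations]
    refine ⟨⟨map_snd_decorate _ _ _, hexpo ▸ subset_rfl⟩, ?_, hexpo⟩
    rw [isChain_decorate]
    intro a ha b hb hab
    obtain ⟨i, rfl⟩ := (hsupp a).mp ha
    obtain ⟨j, rfl⟩ := (hsupp b).mp hb
    rw [hext u hu.2, hext u hu.2]
    exact hu.2 i j hab
  · intro u hu u' hu' h
    rw [Finset.mem_filter] at hu hu'
    rw [decorate_inj] at h
    ext i
    rw [← hext u hu.2, ← hext u' hu'.2, h (w i) ((hsupp _).mpr ⟨i, rfl⟩)]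
  · intro l hl
    rw [Finset.mem_filter, mem_decorations] at hl
    obtain ⟨⟨hl1, -⟩, hl2, hl3⟩ := hl
    obtain ⟨ψ, hψ⟩ := exists_decorate_eq l 1
    rw [hl1] at hψ
    subst hψ
    rw [isChain_decorate] at hl2
    have hanti : ∀ i j, w i ≤ w j → (ψ ∘ w) j ≤ (ψ ∘ w) i := fun i j hij =>
      hl2 ((hsupp _).mpr ⟨i, rfl⟩) ((hsupp _).mpr ⟨j, rfl⟩) hij
    refine ⟨ψ ∘ w, ?_, ?_⟩
    · rw [Finset.mem_filter, mem_words]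
      refine ⟨?_, hanti⟩
      rw [← mapDomain_monoExp, hwα, ← expo_decorate, hl3]
    · rw [decorate_inj]
      intro a ha
      obtain ⟨i, rfl⟩ := (hsupp a).mp ha
      rw [hext _ hanti]
      rfl

open Classical in
/-- The antipode of a word series: the coefficient of a word `u` collects, with sign, the weights of
the packed words `w` along which `u` weakly decreases. -/
theorem coeff_antipode_wordSeries {c : (Fin n → ℕ+) → R} (hc : OrderInvariant c)
    (m : ℕ+ →₀ ℕ) :
    MvPowerSeries.coeff m ((HopfAlgebra.antipode R
      (⟨wordSeries c, wordSeries_mem_QSym hc⟩ : QSym R) : QSym R) : MvPowerSeries ℕ+ R) =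
    ∑ u ∈ words n m, ∑ w ∈ (packedWords n).filter (fun w => ∀ i j, w i ≤ w j → u j ≤ u i),
      (-1) ^ (Finset.univ.image w).card * c w := by
  rw [wordSeries_eq_sum_M hc]
  change MvPowerSeries.coeff m ((antipodeMap R _ : QSym R) : MvPowerSeries ℕ+ R) = _
  have h1 : MvPowerSeries.coeff m ((antipodeMap R (∑ w ∈ packedWords n,
        c w • M R (shape (monoExp w))) : QSym R) : MvPowerSeries ℕ+ R) =
      ∑ w ∈ packedWords n, c w *
        MvPowerSeries.coeff m (antipodeM R (shape (monoExp w)) : MvPowerSeries ℕ+ R) := by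
    simp [map_sum, antipodeMap_M]
  rw [h1]
  simp only [Finset.sum_filter]
  rw [Finset.sum_comm]
  refine Finset.sum_congr rfl fun w hw => ?_
  rw [mem_packedWords] at hw
  have h2 : ((-1 : MvPowerSeries ℕ+ R) ^ (shape (monoExp w)).length) =
      MvPowerSeries.C ((-1 : R) ^ (shape (monoExp w)).length) := by simp
  rw [coeff_antipodeM m.support _ m subset_rfl, h2, MvPowerSeries.coeff_C_mul,
    coeff_weakSeries hw, length_shape, support_monoExp, Finset.card_filter, Nat.cast_sum,
    Finset.mul_sum, Finset.mul_sum]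
  refine Finset.sum_congr rfl fun u _ => ?_
  split_ifs <;> simp [mul_comm]

end QuasiSymm

/-! ### Strictly order preserving surjections -/

namespace PosetCone

open Classical in
/-- The surjections from `s` onto an initial segment `{1, …, k}`, `k ≤ N`, which strictly increase
along the relation `r`. They are extended by `0` outside `s`, so that removing the first block
`w⁻¹(1)` amounts to truncated subtraction of `1`. -/
def strictPackings {α : Type*} [Fintype α] (r : α → α → Prop) (N : ℕ) (s : Finset α) :
    Finset (α → ℕ) :=
  (Fintype.piFinset fun _ => Finset.range (N + 1)).filter fun w =>
    (∀ a, w a ≠ 0 ↔ a ∈ s) ∧ (∀ a, 2 ≤ w a → ∃ b, w b + 1 = w a) ∧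
      ∀ a ∈ s, ∀ b ∈ s, r a b → w a < w b

section

variable {α : Type*} [Fintype α] {r : α → α → Prop} {N : ℕ} {s : Finset α} {w : α → ℕ}

theorem mem_strictPackings : w ∈ strictPackings r N s ↔ (∀ a, w a ≤ N) ∧
    (∀ a, w a ≠ 0 ↔ a ∈ s) ∧ (∀ a, 2 ≤ w a → ∃ b, w b + 1 = w a) ∧
      ∀ a ∈ s, ∀ b ∈ s, r a b → w a < w b := by
  simp [strictPackings]

theorem strictPackings_empty : strictPackings r N ∅ = {0} := by
  ext w
  rw [mem_strictPackings, Finset.mem_singleton]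
  constructor
  · rintro ⟨-, h, -⟩
    ext a
    simpa using h a
  · rintro rfl
    simp

open Classical in
/-- The first block `A = w⁻¹(1)` of a strict packing of `s` is a nonempty set of minimal elements,
and the remaining blocks form an arbitrary strict packing of `s \ A`. -/
theorem sum_first_block (hs : s.Nonempty) :
    ∑ w ∈ strictPackings r (N + 1) s, (-1 : ℤ) ^ (s.image w).card =
      ∑ A ∈ (s.filter fun a => ∀ b ∈ s, ¬ r b a).powerset.erase ∅,
        -∑ w ∈ strictPackings r N (s \ A), (-1 : ℤ) ^ ((s \ A).image w).card := by
  rw [← Finset.sum_fiberwise_of_maps_to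
    (g := fun w : α → ℕ => s.filter fun a => w a = 1)
    (t := (s.filter fun a => ∀ b ∈ s, ¬ r b a).powerset.erase ∅)]
  · refine Finset.sum_congr rfl fun A hA => ?_
    rw [Finset.mem_erase, Finset.mem_powerset] at hA
    obtain ⟨hne, hA⟩ := hA
    have hAs : A ⊆ s := hA.trans (Finset.filter_subset _ _)
    rw [← Finset.sum_neg_distrib]
    refine Finset.sum_bij' (fun w _ a => w a - 1) (fun w _ a => if a ∈ s then w a + 1 else 0)
      ?_ ?_ ?_ ?_ ?_
    · intro w hw
      rw [Finset.mem_filter, mem_strictPackings] at hw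
      obtain ⟨⟨h1, h2, h3, h4⟩, rfl⟩ := hw
      rw [mem_strictPackings]
      refine ⟨fun a => by have := h1 a; omega, fun a => ?_, fun a ha => ?_, ?_⟩
      · rw [Finset.mem_sdiff, Finset.mem_filter, ← h2 a]
        omega
      · obtain ⟨b, hb⟩ := h3 a (by omega)
        exact ⟨b, by omega⟩
      · intro a ha b hb hab
        rw [Finset.mem_sdiff] at ha hb
        have := h4 a ha.1 b hb.1 hab
        have := (h2 a).mpr ha.1
        omega
    · intro w hw
      rw [mem_strictPackings] at hw
      obtain ⟨h1, h2, h3, h4⟩ := hw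
      have hA0 : ∀ a ∈ A, w a = 0 := fun a ha => by
        by_contra h
        exact (Finset.mem_sdiff.mp ((h2 a).mp h)).2 ha
      have hs' : ∀ a, w a ≠ 0 → a ∈ s := fun a h => (Finset.mem_sdiff.mp ((h2 a).mp h)).1
      rw [Finset.mem_filter, mem_strictPackings]
      refine ⟨⟨fun a => ?_, fun a => ?_, fun a ha => ?_, fun a ha b hb hab => ?_⟩, ?_⟩
      · have := h1 a
        split_ifs <;> omega
      · split_ifs with h <;> simp [h]
      · by_cases has : a ∈ s
        · simp only [has, if_true] at ha ⊢
          rcases (show 2 ≤ w a ∨ w a = 1 by omega) with h | h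
          · obtain ⟨b, hb⟩ := h3 a h
            exact ⟨b, by rw [if_pos (hs' b (by omega)), hb]⟩
          · obtain ⟨b, hb⟩ := Finset.nonempty_iff_ne_empty.mpr hne
            exact ⟨b, by rw [if_pos (hAs hb), hA0 b hb, h]⟩
        · simp [has] at ha
      · have hbA : b ∉ A := fun h => (Finset.mem_filter.mp (hA h)).2 a ha hab
        have hb0 := (h2 b).mpr (Finset.mem_sdiff.mpr ⟨hb, hbA⟩)
        simp only [ha, hb, if_true]
        by_cases haA : a ∈ A
        · rw [hA0 a haA]
          omega
        · have := h4 a (Finset.mem_sdiff.mpr ⟨ha, haA⟩) b (Finset.mem_sdiff.mpr ⟨hb, hbA⟩) hab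
          omega
      · ext a
        rw [Finset.mem_filter]
        constructor
        · rintro ⟨has, h⟩
          simp only [has, if_true] at h
          by_contra haA
          exact (h2 a).mpr (Finset.mem_sdiff.mpr ⟨has, haA⟩) (by omega)
        · intro ha
          exact ⟨hAs ha, by simp [hAs ha, hA0 a ha]⟩
    · intro w hw
      rw [Finset.mem_filter, mem_strictPackings] at hw
      obtain ⟨⟨h1, h2, h3, h4⟩, -⟩ := hw
      ext a
      have := h2 a
      split_ifs with h <;> simp only [h, iff_true, iff_false] at this
      · exact Nat.succ_pred this
      · omega
    · intro w hw
      rw [mem_strictPackings] at hw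
      obtain ⟨h1, h2, h3, h4⟩ := hw
      ext a
      by_cases has : a ∈ s
      · simp [has]
      · have := mt (fun h => (Finset.mem_sdiff.mp ((h2 a).mp h)).1) has
        simp only [has, if_false]
        omega
    · intro w hw
      rw [Finset.mem_filter, mem_strictPackings] at hw
      obtain ⟨⟨h1, h2, h3, h4⟩, rfl⟩ := hw
      set A := s.filter fun a => w a = 1 with hAdef
      have himg : s.image w = insert 1 (((s \ A).image fun a => w a - 1).image (· + 1)) := by
        ext k
        simp only [Finset.mem_image, Finset.mem_insert, Finset.mem_sdiff, hAdef,
          Finset.mem_filter]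
        constructor
        · rintro ⟨a, ha, rfl⟩
          by_cases h1a : w a = 1
          · exact Or.inl h1a
          · have := (h2 a).mpr ha
            exact Or.inr ⟨w a - 1, ⟨a, ⟨ha, fun h => h1a h.2⟩, rfl⟩,
              Nat.succ_pred this⟩
        · rintro (rfl | ⟨_, ⟨a, ⟨ha, h⟩, rfl⟩, rfl⟩)
          · obtain ⟨a, ha⟩ := Finset.nonempty_iff_ne_empty.mpr hne
            exact ⟨a, (Finset.mem_filter.mp ha).1, (Finset.mem_filter.mp ha).2⟩
          · have := (h2 a).mpr ha
            exact ⟨a, ha, by omega⟩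
      rw [himg, Finset.card_insert_of_notMem, Finset.card_image_of_injective _
        (add_left_injective 1), pow_succ]
      · ring
      · simp only [Finset.mem_image, not_exists, not_and, hAdef, Finset.mem_sdiff,
          Finset.mem_filter]
        rintro _ ⟨a, ⟨ha, h⟩, rfl⟩ h'
        have := (h2 a).mpr ha
        exact h ha (by omega)
  · intro w hw
    rw [mem_strictPackings] at hw
    obtain ⟨h1, h2, h3, h4⟩ := hw
    rw [Finset.mem_erase, Finset.mem_powerset]
    constructor
    · obtain ⟨a, ha, hmin⟩ := s.exists_min_image w hs
      have ha0 := (h2 a).mpr ha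
      refine Finset.Nonempty.ne_empty ⟨a, Finset.mem_filter.mpr ⟨ha, ?_⟩⟩
      by_contra hne
      obtain ⟨b, hb⟩ := h3 a (by omega)
      have := hmin b ((h2 b).mp (by omega))
      omega
    · intro a ha
      rw [Finset.mem_filter] at ha ⊢
      refine ⟨ha.1, fun b hb hba => ?_⟩
      have := h4 b hb a ha.1 hba
      have := (h2 b).mpr hb
      omega

/-- The reciprocity `∑_k (-1)^k #{strictly order preserving surjections s → [k]} = (-1)^{|s|}` for an
acyclic relation; combinatorially, the Euler characteristic of an open cone of the braid
arrangement. -/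
theorem sum_strictPackings {β : Type*} [LinearOrder β] (h : α → β)
    (hr : ∀ a b, r a b → h a < h b) :
    ∀ (N : ℕ) (s : Finset α), s.card ≤ N →
      ∑ w ∈ strictPackings r N s, (-1 : ℤ) ^ (s.image w).card = (-1) ^ s.card := by
  classical
  intro N
  induction N with
  | zero =>
    intro s hs
    obtain rfl := Finset.card_eq_zero.mp (Nat.le_zero.mp hs)
    simp [strictPackings_empty]
  | succ N ih =>
    intro s hs
    rcases s.eq_empty_or_nonempty with rfl | hne
    · simp [strictPackings_empty]
    rw [sum_first_block hne]
    set T := s.filter fun a => ∀ b ∈ s, ¬ r b a with hT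
    have hTs : T ⊆ s := Finset.filter_subset _ _
    have hTne : T.Nonempty := by
      obtain ⟨a, ha, hmin⟩ := s.exists_min_image h hne
      exact ⟨a, Finset.mem_filter.mpr ⟨ha, fun b hb hba => (hr b a hba).not_ge (hmin b hb)⟩⟩
    have h1 : ∀ A ∈ T.powerset.erase ∅,
        -∑ w ∈ strictPackings r N (s \ A), (-1 : ℤ) ^ ((s \ A).image w).card =
          -(-1) ^ s.card * (-1) ^ A.card := by
      intro A hA
      rw [Finset.mem_erase, Finset.mem_powerset] at hA
      have hAs := hA.2.trans hTs
      have hc := Finset.card_sdiff_add_card_eq_card hAs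
      have hpos := Finset.card_pos.mpr (Finset.nonempty_iff_ne_empty.mpr hA.1)
      rw [ih _ (by omega), ← hc, pow_add]
      have : ((-1 : ℤ) ^ A.card) * (-1) ^ A.card = 1 := by
        rw [← mul_pow]; simp
      linear_combination (-1 : ℤ) ^ (s \ A).card * this
    rw [Finset.sum_congr rfl h1, ← Finset.mul_sum]
    have h2 := Finset.sum_erase_add T.powerset (fun A => (-1 : ℤ) ^ A.card)
      (Finset.empty_mem_powerset T)
    rw [Finset.sum_powerset_neg_one_pow_card_of_nonempty hTne] at h2
    simp only [Finset.card_empty, pow_zero] at h2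
    linear_combination (-(-1 : ℤ) ^ s.card) * h2

end
end PosetCone

/-! ### Cones generated by differences of basis vectors -/

namespace PosetCone

variable {n : ℕ}

/-- The cone generated by the vectors `e_i - e_j` with `r i j`, for an arbitrary relation `r`. -/
def relCone (r : Fin n → Fin n → Prop) : Set (Fin n → ℝ) :=
  (PointedCone.hull ℝ {v : Fin n → ℝ |
    ∃ i j, r i j ∧ v = Pi.single i 1 - Pi.single j 1} : Set (Fin n → ℝ))

/-- The part of the relation `r` on the level sets of `ω`. -/
def tight {β : Type*} (r : Fin n → Fin n → Prop) (ω : Fin n → β) (i j : Fin n) : Prop :=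
  r i j ∧ ω i = ω j

/-- `ω` is weakly increasing along the relation `r`. -/
def MonoAlong {β : Type*} [LE β] (r : Fin n → Fin n → Prop) (ω : Fin n → β) : Prop :=
  ∀ i j, r i j → ω i ≤ ω j

variable {r : Fin n → Fin n → Prop} {ω ν : Fin n → ℝ}

theorem dotProduct_single_sub_single (ω : Fin n → ℝ) (i j : Fin n) :
    ω ⬝ᵥ (Pi.single i 1 - Pi.single j 1) = ω i - ω j := by
  simp [dotProduct_sub]

theorem single_sub_single_mem {i j : Fin n} (h : r i j) :
    (Pi.single i 1 - Pi.single j 1 : Fin n → ℝ) ∈ relCone r :=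
  Submodule.subset_span ⟨i, j, h, rfl⟩

theorem zero_mem_relCone : (0 : Fin n → ℝ) ∈ relCone r := Submodule.zero_mem _

theorem relCone_mono {r' : Fin n → Fin n → Prop} (h : ∀ i j, r i j → r' i j) :
    relCone r ⊆ relCone r' :=
  Submodule.span_mono fun _ ⟨i, j, hij, hv⟩ => ⟨i, j, h i j hij, hv⟩

theorem dotProduct_nonpos_and_mem (hω : MonoAlong r ω) {x : Fin n → ℝ} (hx : x ∈ relCone r) :
    ω ⬝ᵥ x ≤ 0 ∧ (ω ⬝ᵥ x = 0 → x ∈ relCone (tight r ω)) := by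
  induction hx using Submodule.span_induction with
  | mem x h =>
    obtain ⟨i, j, hij, rfl⟩ := h
    rw [dotProduct_single_sub_single]
    exact ⟨sub_nonpos.mpr (hω i j hij),
      fun h => single_sub_single_mem ⟨hij, sub_eq_zero.mp h⟩⟩
  | zero => exact ⟨by simp, fun _ => zero_mem_relCone⟩
  | add x y _ _ hx hy =>
    rw [dotProduct_add]
    refine ⟨add_nonpos hx.1 hy.1, fun h => ?_⟩
    have h1 := hx.1
    have h2 := hy.1
    exact Submodule.add_mem _ (hx.2 (by linarith)) (hy.2 (by linarith))
  | smul c x _ hx =>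
    have hc : ω ⬝ᵥ (c • x) = (c : ℝ) * (ω ⬝ᵥ x) := by
      rw [dotProduct_smul]; rfl
    rw [hc]
    refine ⟨mul_nonpos_of_nonneg_of_nonpos c.2 hx.1, fun h => ?_⟩
    rcases mul_eq_zero.mp h with h | h
    · have : c = 0 := Subtype.ext h
      rw [this, zero_smul]
      exact zero_mem_relCone
    · exact Submodule.smul_mem _ c (hx.2 h)

theorem dotProduct_eq_zero_of_mem_tight {x : Fin n → ℝ} (hx : x ∈ relCone (tight r ω)) :
    ω ⬝ᵥ x = 0 := by
  have h1 := (dotProduct_nonpos_and_mem (r := tight r ω) (fun i j h => h.2.le) hx).1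
  have h2 := (dotProduct_nonpos_and_mem (r := tight r ω) (ω := -ω)
    (fun i j h => (neg_le_neg h.2.ge)) hx).1
  rw [neg_dotProduct] at h2
  linarith

/-- The face of `relCone r` on which `ω` is maximal is generated by the generators it contains. -/
theorem mem_relCone_tight_iff (hω : MonoAlong r ω) {x : Fin n → ℝ} :
    x ∈ relCone (tight r ω) ↔ x ∈ relCone r ∧ ω ⬝ᵥ x = 0 :=
  ⟨fun h => ⟨relCone_mono (fun _ _ h => h.1) h, dotProduct_eq_zero_of_mem_tight h⟩,
    fun h => (dotProduct_nonpos_and_mem hω h.1).2 h.2⟩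

theorem relCone_tight_eq_iff (hω : MonoAlong r ω) (hν : MonoAlong r ν) :
    relCone (tight r ω) = relCone (tight r ν) ↔ ∀ i j, r i j → (ω i = ω j ↔ ν i = ν j) := by
  constructor
  · have key : ∀ {ω ν : Fin n → ℝ}, MonoAlong r ν → relCone (tight r ω) = relCone (tight r ν) →
        ∀ i j, r i j → ω i = ω j → ν i = ν j := by
      intro ω ν hν h i j hij hω
      have := single_sub_single_mem (r := tight r ω) ⟨hij, hω⟩
      rw [h, mem_relCone_tight_iff hν, dotProduct_single_sub_single] at this
      exact sub_eq_zero.mp this.2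
    exact fun h i j hij => ⟨key hν h i j hij, key hω h.symm i j hij⟩
  · intro h
    congr 1
    ext i j
    exact and_congr_right fun hij => h i j hij

theorem mem_faces_iff {G : Set (Fin n → ℝ)} :
    G ∈ faces (relCone r) ↔ ∃ ω : Fin n → ℝ, MonoAlong r ω ∧ G = relCone (tight r ω) := by
  constructor
  · rintro ⟨hne, hexp⟩
    obtain ⟨l, hl⟩ := hexp hne
    have hlω : ∀ x, l x = (fun i => l (Pi.single i 1)) ⬝ᵥ x := by
      intro x
      have := LinearMap.pi_apply_eq_sum_univ (l : (Fin n → ℝ) →ₗ[ℝ] ℝ) x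
      change l x = _ at this
      rw [this]
      refine Finset.sum_congr rfl fun i _ => ?_
      have he : (fun j => if i = j then (1 : ℝ) else 0) = Pi.single i 1 := by
        ext j
        simp [Pi.single_apply, eq_comm]
      rw [smul_eq_mul, mul_comm, he]
      rfl
    set ω : Fin n → ℝ := fun i => l (Pi.single i 1) with hω
    obtain ⟨x, hx⟩ := hne
    rw [hl] at hx
    have hub : ∀ y ∈ relCone r, ω ⬝ᵥ y ≤ ω ⬝ᵥ x := fun y hy => by
      rw [← hlω, ← hlω]; exact hx.2 y hy
    -- a linear functional that is bounded above on a cone is nonpositive on it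
    have hmono : MonoAlong r ω := by
      intro i j hij
      have h1 := hub (x + (Pi.single i 1 - Pi.single j 1))
        (Submodule.add_mem _ hx.1 (single_sub_single_mem hij))
      rw [dotProduct_add, dotProduct_single_sub_single] at h1
      linarith
    refine ⟨ω, hmono, ?_⟩
    ext y
    rw [mem_relCone_tight_iff hmono, hl]
    refine and_congr_right fun hy => ⟨fun h => ?_, fun h z hz => ?_⟩
    · have h0 := h 0 zero_mem_relCone
      rw [map_zero, hlω] at h0
      exact le_antisymm (dotProduct_nonpos_and_mem hmono hy).1 h0
    · rw [hlω, hlω y, h]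
      exact (dotProduct_nonpos_and_mem hmono hz).1
  · rintro ⟨ω, hω, rfl⟩
    refine ⟨⟨0, zero_mem_relCone⟩, fun _ => ?_⟩
    let f : (Fin n → ℝ) →ₗ[ℝ] ℝ :=
      { toFun := fun x => ω ⬝ᵥ x
        map_add' := fun x y => dotProduct_add ω x y
        map_smul' := fun c x => dotProduct_smul c ω x }
    refine ⟨LinearMap.toContinuousLinearMap f, ?_⟩
    ext y
    rw [mem_relCone_tight_iff hω]
    refine and_congr_right fun hy => ⟨fun h z hz => ?_, fun h => ?_⟩
    · change ω ⬝ᵥ z ≤ ω ⬝ᵥ y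
      rw [h]
      exact (dotProduct_nonpos_and_mem hω hz).1
    · have h0 : ω ⬝ᵥ 0 ≤ ω ⬝ᵥ y := h 0 zero_mem_relCone
      rw [dotProduct_zero] at h0
      exact le_antisymm (dotProduct_nonpos_and_mem hω hy).1 h0

theorem finite_faces_relCone : (faces (relCone r)).Finite :=
  (Set.finite_range fun s : Fin n → Fin n → Prop => relCone s).subset fun G hG => by
    obtain ⟨ω, -, rfl⟩ := mem_faces_iff.mp hG
    exact ⟨_, rfl⟩

theorem mem_normalCone_iff :
    ω ∈ normalCone (relCone r) (relCone (tight r ν)) ↔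
      MonoAlong r ω ∧ ∀ i j, r i j → ν i = ν j → ω i = ω j := by
  constructor
  · intro h
    have hmono : MonoAlong r ω := fun i j hij => by
      have := h 0 zero_mem_relCone _ (single_sub_single_mem hij)
      rw [dotProduct_zero, dotProduct_single_sub_single] at this
      linarith
    refine ⟨hmono, fun i j hij hν => le_antisymm (hmono i j hij) ?_⟩
    have := h _ (single_sub_single_mem (r := tight r ν) ⟨hij, hν⟩) 0 zero_mem_relCone
    rw [dotProduct_zero, dotProduct_single_sub_single] at this
    linarith
  · rintro ⟨hmono, heq⟩ x hx y hy
    have : x ∈ relCone (tight r ω) :=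
      relCone_mono (fun i j h => ⟨h.1, heq i j h.1 h.2⟩) hx
    rw [dotProduct_eq_zero_of_mem_tight this]
    exact (dotProduct_nonpos_and_mem hmono hy).1

/-- The relative interior of the normal cone at a face consists of the weights that are maximal
exactly on this face. -/
theorem mem_intrinsicInterior_normalCone_iff (hν : MonoAlong r ν) :
    ω ∈ intrinsicInterior ℝ (normalCone (relCone r) (relCone (tight r ν))) ↔
      MonoAlong r ω ∧ ∀ i j, r i j → (ω i = ω j ↔ ν i = ν j) := by
  set s := normalCone (relCone r) (relCone (tight r ν)) with hs
  constructor
  · rintro ⟨y, hy, rfl⟩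
    have hsub : ∀ z : affineSpan ℝ s, z ∈ interior ((↑) ⁻¹' s : Set (affineSpan ℝ s)) →
        (z : Fin n → ℝ) ∈ s := fun z hz => by
      have : z ∈ ((↑) ⁻¹' s : Set (affineSpan ℝ s)) := interior_subset hz
      exact this
    have hys := hsub y hy
    obtain ⟨hymono, hyeq⟩ := mem_normalCone_iff.mp hys
    refine ⟨hymono, fun i j hij => ⟨fun h => ?_, hyeq i j hij⟩⟩
    have hνs : ν ∈ s := mem_normalCone_iff.mpr ⟨hν, fun _ _ _ h => h⟩
    -- the segment from `ν` to `y` can be prolonged beyond `y` inside the normal cone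
    let γ : ℝ → affineSpan ℝ s := fun t =>
      ⟨AffineMap.lineMap (y : Fin n → ℝ) ν t,
        AffineMap.lineMap_mem t y.2 (subset_affineSpan ℝ s hνs)⟩
    have hγ : Continuous γ := by
      refine Continuous.subtype_mk ?_ _
      exact AffineMap.lineMap_continuous
    have h0 : γ 0 = y := Subtype.ext (by simp [γ])
    have hnhds : ∀ᶠ t in nhds (0 : ℝ), γ t ∈ interior ((↑) ⁻¹' s : Set (affineSpan ℝ s)) :=
      hγ.continuousAt.eventually_mem (by rw [h0]; exact isOpen_interior.mem_nhds hy)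
    obtain ⟨ε, hε, hball⟩ := Metric.eventually_nhds_iff.mp hnhds
    have hmem := hsub _ (hball (y := -(ε / 2)) (by
      rw [Real.dist_eq, sub_zero, abs_neg, abs_of_pos (by linarith)]; linarith))
    have hle := (mem_normalCone_iff.mp hmem).1 i j hij
    simp only [γ, AffineMap.lineMap_apply, vsub_eq_sub, vadd_eq_add, Pi.add_apply, Pi.smul_apply,
      Pi.sub_apply, smul_eq_mul, h] at hle
    have h3 := hν i j hij
    nlinarith
  · rintro ⟨hmono, heq⟩
    have hωs : ω ∈ s := mem_normalCone_iff.mpr ⟨hmono, fun i j hij => (heq i j hij).mpr⟩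
    refine ⟨⟨ω, subset_affineSpan ℝ s hωs⟩, ?_, rfl⟩
    rw [mem_interior]
    refine ⟨(↑) ⁻¹' {x : Fin n → ℝ | ∀ i j, r i j → ν i ≠ ν j → x i < x j}, ?_, ?_, ?_⟩
    · rintro ⟨x, hx⟩ hxU
      let L : Submodule ℝ (Fin n → ℝ) :=
        { carrier := {x | ∀ i j, r i j → ν i = ν j → x i = x j}
          zero_mem' := fun i j _ _ => rfl
          add_mem' := fun {a b} ha hb i j h h' => by
            simp only [Pi.add_apply, ha i j h h', hb i j h h']
          smul_mem' := fun c a ha i j h h' => by simp only [Pi.smul_apply, ha i j h h'] }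
      have hxL : x ∈ L := (Submodule.span_le (p := L)).mpr
        (fun z hz => (mem_normalCone_iff.mp hz).2) (affineSpan_subset_span hx)
      refine mem_normalCone_iff.mpr ⟨fun i j hij => ?_, hxL⟩
      by_cases h : ν i = ν j
      · exact (hxL i j hij h).le
      · exact (hxU i j hij h).le
    · refine IsOpen.preimage continuous_subtype_val ?_
      simp only [Set.ofPred_forall]
      refine isOpen_iInter_of_finite fun i => isOpen_iInter_of_finite fun j =>
        isOpen_iInter_of_finite fun _ => isOpen_iInter_of_finite fun _ => ?_
      exact isOpen_lt (continuous_apply i) (continuous_apply j)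
    · exact fun i j hij h => lt_of_le_of_ne (hmono i j hij) (mt (heq i j hij).mp h)

/-- The dimension of `relCone r` is `n` minus the number of connected components of `r`: the linear
functionals vanishing on it are the functions constant on components. -/
theorem dim_relCone_add_card (r : Fin n → Fin n → Prop) :
    dim (relCone r) + Nat.card (Quot r) = n := by
  classical
  have : Finite (Quot r) := Finite.of_surjective (Quot.mk r) Quot.mk_surjective
  have := Fintype.ofFinite (Quot r)
  set S : Set (Fin n → ℝ) := {v | ∃ i j, r i j ∧ v = Pi.single i 1 - Pi.single j 1} with hS
  have h1 : vectorSpan ℝ (relCone r) = Submodule.span ℝ S := by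
    rw [vectorSpan_eq_span_vsub_set_right ℝ (zero_mem_relCone (r := r))]
    simp only [vsub_eq_sub, sub_zero, Set.image_id']
    exact Submodule.span_span_of_tower _ ℝ S
  let e : (Submodule.span ℝ S).dualAnnihilator ≃ₗ[ℝ] (Quot r → ℝ) :=
    { toFun := fun φ => Quot.lift (fun i => φ.1 (Pi.single i 1)) fun i j hij => by
        have := (Submodule.mem_dualAnnihilator φ.1).mp φ.2 _
          (Submodule.subset_span ⟨i, j, hij, rfl⟩)
        rw [map_sub] at this
        exact sub_eq_zero.mp this
      map_add' := fun φ ψ => funext fun q => by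
        induction q using Quot.ind; rfl
      map_smul' := fun c φ => funext fun q => by
        induction q using Quot.ind; rfl
      invFun := fun f => ⟨∑ i, f (Quot.mk r i) • LinearMap.proj i, by
        rw [Submodule.mem_dualAnnihilator]
        intro x hx
        induction hx using Submodule.span_induction with
        | mem x h =>
          obtain ⟨i, j, hij, rfl⟩ := h
          simp [Pi.single_apply, mul_sub, Finset.sum_sub_distrib, Quot.sound hij]
        | zero => simp
        | add x y _ _ hx hy => rw [map_add, hx, hy, add_zero]
        | smul c x _ hx => rw [map_smul, hx, smul_zero]⟩
      left_inv := fun φ => by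
        refine Subtype.ext (LinearMap.pi_ext' fun i => LinearMap.ext_ring ?_)
        simp [Pi.single_apply]
      right_inv := fun f => funext fun q => by
        induction q using Quot.ind
        simp [Pi.single_apply] }
  have h2 := Subspace.finrank_add_finrank_dualAnnihilator_eq (Submodule.span ℝ S)
  rw [e.finrank_eq, Module.finrank_fintype_fun_eq_card, Module.finrank_fintype_fun_eq_card,
    Fintype.card_fin] at h2
  rw [dim, h1, Nat.card_eq_fintype_card, h2]

end PosetCone

/-! ### The weighted enumerator as a series over words -/

namespace PosetCone
open QuasiSymm

variable {n : ℕ}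

/-- A word, regarded as an integer point of `ℝⁿ`. -/
def toPoint (w : Fin n → ℕ+) : Fin n → ℝ := fun i => ((w i : ℕ) : ℝ)

theorem tight_toPoint (r : Fin n → Fin n → Prop) (w : Fin n → ℕ+) :
    tight r (toPoint w) = tight r w := by
  ext i j
  simp [tight, toPoint]

theorem monoAlong_toPoint (r : Fin n → Fin n → Prop) (w : Fin n → ℕ+) :
    MonoAlong r (toPoint w) ↔ MonoAlong r w := by
  simp [MonoAlong, toPoint]

open Classical in
theorem coeff_enumerator (R : Type*) [CommRing R] (A : Set (Fin n → ℝ)) (m : ℕ+ →₀ ℕ) :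
    MvPowerSeries.coeff m (enumerator R A) =
      (((words n m).filter fun w => toPoint w ∈ A).card : R) := by
  rw [enumerator, coeff_ofCoeff]
  congr 1
  rw [← Set.ncard_coe_finset]
  congr 1
  ext w
  simp only [Set.mem_ofPred_eq, Finset.coe_filter, mem_words, monoExp]
  exact and_comm

section Weight

variable {R : Type*} [CommRing R] (q : R) (r : Fin n → Fin n → Prop)

open Classical in
/-- The contribution of the word `w` to the weighted enumerator of `relCone r`: the power of `q`
recording the dimension of the face on which `w` is maximal, if `w` is bounded above on the cone. -/
def wordWeight (w : Fin n → ℕ+) : R :=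
  if MonoAlong r w then q ^ dim (relCone (tight r w)) else 0

theorem orderInvariant_wordWeight : OrderInvariant (wordWeight q r) := by
  classical
  intro w φ hφ
  have h1 : MonoAlong r (φ ∘ w) ↔ MonoAlong r w :=
    forall₃_congr fun i j _ => hφ.le_iff_le ⟨i, rfl⟩ ⟨j, rfl⟩
  have h2 : tight r (φ ∘ w) = tight r w := by
    ext i j
    exact and_congr_right fun _ => hφ.injOn.eq_iff ⟨i, rfl⟩ ⟨j, rfl⟩
  unfold wordWeight
  rw [h2]
  exact if_congr h1 rfl rfl

theorem mem_intrinsicInterior_iff_of_mem_faces {r : Fin n → Fin n → Prop} {ω : Fin n → ℝ}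
    {G : Set (Fin n → ℝ)} (hG : G ∈ faces (relCone r)) :
    ω ∈ intrinsicInterior ℝ (normalCone (relCone r) G) ↔
      MonoAlong r ω ∧ relCone (tight r ω) = G := by
  obtain ⟨ν, hν, rfl⟩ := mem_faces_iff.mp hG
  rw [mem_intrinsicInterior_normalCone_iff hν]
  exact and_congr_right fun hω => (relCone_tight_eq_iff hω hν).symm

theorem weightedEnumerator_relCone :
    weightedEnumerator q (relCone r) = wordSeries (wordWeight q r) := by
  classical
  rw [weightedEnumerator, finsum_mem_eq_finite_toFinset_sum _ finite_faces_relCone]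
  ext m
  rw [map_sum, wordSeries, coeff_ofCoeff]
  have h1 : ∀ G ∈ (finite_faces_relCone (r := r)).toFinset,
      MvPowerSeries.coeff m (faceEnumerator q (relCone r) G) =
        ∑ w ∈ words n m, if MonoAlong r w ∧ relCone (tight r w) = G then q ^ dim G else 0 := by
    intro G hG
    rw [Set.Finite.mem_toFinset] at hG
    rw [faceEnumerator, MvPowerSeries.coeff_smul, coeff_enumerator, Finset.card_filter,
      Nat.cast_sum, Finset.mul_sum]
    refine Finset.sum_congr rfl fun w _ => ?_
    rw [mem_intrinsicInterior_iff_of_mem_faces hG, monoAlong_toPoint, tight_toPoint]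
    split_ifs <;> simp
  rw [Finset.sum_congr rfl h1, Finset.sum_comm]
  refine Finset.sum_congr rfl fun w _ => ?_
  rw [wordWeight]
  split_ifs with hw
  · simp only [hw, true_and]
    rw [Finset.sum_ite_eq, if_pos]
    rw [Set.Finite.mem_toFinset, mem_faces_iff]
    exact ⟨toPoint w, (monoAlong_toPoint r w).mpr hw, by rw [tight_toPoint]⟩
  · simp [hw]

theorem aeval_fPolynomial_relCone (x : R) :
    Polynomial.aeval x (fPolynomial (relCone r)) =
      ∑ G ∈ (finite_faces_relCone (r := r)).toFinset, x ^ dim G := by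
  classical
  rw [fPolynomial, map_sum, ← Finset.sum_fiberwise_of_maps_to (g := dim)
    (t := Finset.range (n + 1))]
  · refine Finset.sum_congr rfl fun i _ => ?_
    have hc : {G | G ∈ faces (relCone r) ∧ dim G = i}.ncard =
        ((finite_faces_relCone (r := r)).toFinset.filter fun G => dim G = i).card := by
      rw [← Set.ncard_coe_finset]
      congr 1
      ext G
      simp
    rw [hc, Finset.sum_congr rfl fun G hG => by rw [(Finset.mem_filter.mp hG).2],
      Finset.sum_const, nsmul_eq_mul]
    simp
  · intro G _
    rw [Finset.mem_range, Nat.lt_succ_iff]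
    exact (Submodule.finrank_le _).trans (by simp)

end Weight

theorem isPacked_of_pred {w : Fin n → ℕ+}
    (h : ∀ i, 2 ≤ (w i : ℕ) → ∃ j, (w j : ℕ) + 1 = w i) : IsPacked w := by
  intro i a ha
  induction hk : (w i : ℕ) - a generalizing i with
  | zero =>
    have := (PNat.coe_le_coe _ _).mpr ha
    exact ⟨i, PNat.coe_inj.mp (by omega)⟩
  | succ k ih =>
    have := a.pos
    obtain ⟨j, hj⟩ := h i (by omega)
    exact ih j ((PNat.coe_le_coe _ _).mp (by omega)) (by omega)

open Classical in
/-- The signed count of the packed words that are strictly increasing along the strict part of `r`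
(and refine the order of `-u`) while being constant along its tight part, by applying
`sum_strictPackings` to the quotient by the tight part. -/
theorem sum_packedWords_face {r : Fin n → Fin n → Prop} {u : Fin n → ℕ+} {ν : Fin n → ℝ}
    (hν : MonoAlong (tight r u) ν) :
    ∑ w ∈ (packedWords n).filter (fun w =>
        (∀ i j, tight (tight r u) ν i j → w i = w j) ∧
        (∀ i j, tight r u i j → ν i ≠ ν j → w i < w j) ∧ ∀ i j, u j < u i → w i < w j),
      (-1 : ℤ) ^ (Finset.univ.image w).card = (-1) ^ Nat.card (Quot (tight (tight r u) ν)) := by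
  set t := tight (tight r u) ν with ht
  have : Finite (Quot t) := Finite.of_surjective (Quot.mk t) Quot.mk_surjective
  have := Fintype.ofFinite (Quot t)
  let rel : Quot t → Quot t → Prop := fun a b => ∃ i j, Quot.mk t i = a ∧ Quot.mk t j = b ∧
    ((tight r u i j ∧ ν i ≠ ν j) ∨ u j < u i)
  -- `rel` is acyclic because it increases the lexicographic height `(-u, ν)`
  let h : Quot t → ℕ+ᵒᵈ ×ₗ ℝ := Quot.lift (fun i => toLex (OrderDual.toDual (u i), ν i))
    fun i j hij => by rw [hij.1.2, hij.2]
  have hrel : ∀ a b, rel a b → h a < h b := by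
    rintro _ _ ⟨i, j, rfl, rfl, hij⟩
    change toLex (OrderDual.toDual (u i), ν i) < toLex (OrderDual.toDual (u j), ν j)
    rw [Prod.Lex.toLex_lt_toLex]
    rcases hij with ⟨h1, h2⟩ | h1
    · exact Or.inr ⟨congrArg OrderDual.toDual h1.2, lt_of_le_of_ne (hν i j h1) h2⟩
    · exact Or.inl (OrderDual.toDual_lt_toDual.mpr h1)
  have key := sum_strictPackings h hrel (Fintype.card (Quot t)) Finset.univ le_rfl
  rw [Finset.card_univ] at key
  rw [Nat.card_eq_fintype_card, ← key]
  symm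
  have hcoe : ∀ {w' : Quot t → ℕ}, (∀ a, w' a ≠ 0 ↔ a ∈ Finset.univ) →
      ∀ a, ((w' a).toPNat' : ℕ) = w' a := fun hw a => by
    rw [Nat.toPNat'_coe, if_pos (Nat.pos_of_ne_zero ((hw a).mpr (Finset.mem_univ _)))]
  refine Finset.sum_bij (fun w' _ i => (w' (Quot.mk t i)).toPNat') ?_ ?_ ?_ ?_
  · intro w' hw'
    obtain ⟨-, h2, h3, h4⟩ := mem_strictPackings.mp hw'
    have hc := hcoe h2
    rw [Finset.mem_filter, mem_packedWords]
    refine ⟨isPacked_of_pred fun i hi => ?_, fun i j hij => ?_, fun i j hij hne => ?_,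
      fun i j hij => ?_⟩
    · rw [hc] at hi ⊢
      obtain ⟨b, hb⟩ := h3 _ hi
      obtain ⟨j, rfl⟩ := Quot.mk_surjective b
      exact ⟨j, by rw [hc, hb]⟩
    · change (w' (Quot.mk t i)).toPNat' = (w' (Quot.mk t j)).toPNat'
      rw [Quot.sound hij]
    · rw [← PNat.coe_lt_coe, hc, hc]
      exact h4 _ (Finset.mem_univ _) _ (Finset.mem_univ _) ⟨i, j, rfl, rfl, Or.inl ⟨hij, hne⟩⟩
    · rw [← PNat.coe_lt_coe, hc, hc]
      exact h4 _ (Finset.mem_univ _) _ (Finset.mem_univ _) ⟨i, j, rfl, rfl, Or.inr hij⟩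
  · intro w₁ hw₁ w₂ hw₂ heq
    ext a
    obtain ⟨i, rfl⟩ := Quot.mk_surjective a
    rw [← hcoe (mem_strictPackings.mp hw₁).2.1, ← hcoe (mem_strictPackings.mp hw₂).2.1]
    exact congrArg PNat.val (congrFun heq i)
  · intro w hw
    rw [Finset.mem_filter, mem_packedWords] at hw
    obtain ⟨hp, h1, h2, h3⟩ := hw
    let w' : Quot t → ℕ := Quot.lift (fun i => (w i : ℕ)) fun i j hij => by rw [h1 i j hij]
    have hw' : ∀ i, w' (Quot.mk t i) = w i := fun _ => rfl
    refine ⟨w', ?_, ?_⟩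
    · rw [mem_strictPackings]
      refine ⟨fun a => ?_, fun a => ?_, fun a ha => ?_, ?_⟩
      · obtain ⟨i, rfl⟩ := Quot.mk_surjective a
        refine ((hp.mem_image_iff (w i)).mp (Finset.mem_image_of_mem _ (Finset.mem_univ _))).trans
          ?_
        have hsub : Finset.univ.image w ⊆ Finset.univ.image fun a => (w' a).toPNat' := by
          intro b hb
          obtain ⟨j, -, rfl⟩ := Finset.mem_image.mp hb
          exact Finset.mem_image.mpr ⟨Quot.mk t j, Finset.mem_univ _, by rw [hw']; simp⟩
        exact (Finset.card_le_card hsub).trans Finset.card_image_le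
      · obtain ⟨i, rfl⟩ := Quot.mk_surjective a
        simp [hw']
      · obtain ⟨i, rfl⟩ := Quot.mk_surjective a
        rw [hw'] at ha ⊢
        obtain ⟨j, hj⟩ := hp i ⟨(w i : ℕ) - 1, by omega⟩
          ((PNat.coe_le_coe _ _).mp (by rw [PNat.mk_coe]; omega))
        refine ⟨Quot.mk t j, ?_⟩
        rw [hw', hj, PNat.mk_coe]
        omega
      · rintro _ - _ - ⟨i, j, rfl, rfl, hij⟩
        rw [hw', hw', PNat.coe_lt_coe]
        rcases hij with hij | hij
        · exact h2 i j hij.1 hij.2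
        · exact h3 i j hij
    · ext i
      simp [hw']
  · intro w' hw'
    obtain ⟨-, h2, -, -⟩ := mem_strictPackings.mp hw'
    have himg : (Finset.univ.image fun i => (w' (Quot.mk t i)).toPNat') =
        (Finset.univ.image w').image Nat.toPNat' := by
      ext b
      simp only [Finset.mem_image, Finset.mem_univ, true_and, exists_exists_eq_and]
      exact (Quot.mk_surjective.exists (p := fun a => (w' a).toPNat' = b)).symm
    rw [himg, Finset.card_image_of_injOn (s := Finset.univ.image w') (f := Nat.toPNat')]
    intro x hx y hy hxy
    simp only [Finset.coe_image, Finset.coe_univ, Set.image_univ, Set.mem_range] at hx hy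
    obtain ⟨a, rfl⟩ := hx
    obtain ⟨b, rfl⟩ := hy
    rw [← hcoe h2 a, ← hcoe h2 b, hxy]

open Classical in
/-- The coefficient of a word `u` in the antipode of the weighted enumerator. The packed words
along which `u` decreases are sorted by the face of `relCone (tight r u)` on which they are
maximal. -/
theorem sum_packedWords_wordWeight {R : Type*} [CommRing R] (q : R)
    {r : Fin n → Fin n → Prop} {u : Fin n → ℕ+} (hu : ∀ i j, r i j → u j ≤ u i) :
    ∑ w ∈ (packedWords n).filter (fun w => ∀ i j, w i ≤ w j → u j ≤ u i),
      (-1) ^ (Finset.univ.image w).card * wordWeight q r w =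
    (-1) ^ n * Polynomial.aeval (-q) (fPolynomial (relCone (tight r u))) := by
  rw [aeval_fPolynomial_relCone, Finset.mul_sum]
  have htight : ∀ w : Fin n → ℕ+, (∀ i j, w i ≤ w j → u j ≤ u i) →
      tight r w = tight (tight r u) w := by
    intro w hw
    ext i j
    exact ⟨fun h => ⟨⟨h.1, le_antisymm (hw _ _ h.2.ge) (hw _ _ h.2.le)⟩, h.2⟩,
      fun h => ⟨h.1.1, h.2⟩⟩
  simp only [wordWeight, mul_ite, mul_zero]
  rw [← Finset.sum_filter, Finset.filter_filter,
    ← Finset.sum_fiberwise_of_maps_to (g := fun w => relCone (tight r w))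
      (t := (finite_faces_relCone (r := tight r u)).toFinset)]
  · refine Finset.sum_congr rfl fun G hG => ?_
    rw [Set.Finite.mem_toFinset, mem_faces_iff] at hG
    obtain ⟨ν, hν, rfl⟩ := hG
    have h1 := dim_relCone_add_card (tight (tight r u) ν)
    have h2 := sum_packedWords_face hν
    rw [Finset.filter_filter, Finset.sum_congr rfl fun w hw => by
      rw [(Finset.mem_filter.mp hw).2.2], ← Finset.sum_mul]
    have hset : ((packedWords n).filter fun w => ((∀ i j, w i ≤ w j → u j ≤ u i) ∧
        MonoAlong r w) ∧ relCone (tight r w) = relCone (tight (tight r u) ν)) =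
        (packedWords n).filter (fun w =>
          (∀ i j, tight (tight r u) ν i j → w i = w j) ∧
          (∀ i j, tight r u i j → ν i ≠ ν j → w i < w j) ∧ ∀ i j, u j < u i → w i < w j) := by
      refine Finset.filter_congr fun w _ => ?_
      constructor
      · rintro ⟨⟨ha, hm⟩, hG⟩
        have hm' : MonoAlong (tight r u) (toPoint w) :=
          (monoAlong_toPoint _ _).mpr fun i j h => hm i j h.1
        rw [htight w ha, ← tight_toPoint, relCone_tight_eq_iff hm' hν] at hG
        have hG' : ∀ i j, tight r u i j → (w i = w j ↔ ν i = ν j) := fun i j h => by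
          rw [← hG i j h]
          simp [toPoint]
        exact ⟨fun i j h => (hG' i j h.1).mpr h.2,
          fun i j h hne => lt_of_le_of_ne (hm i j h.1) (mt (hG' i j h).mp hne),
          fun i j h => lt_of_not_ge fun hle => h.not_ge (ha j i hle)⟩
      · rintro ⟨h1, h2, h3⟩
        have ha : ∀ i j, w i ≤ w j → u j ≤ u i := fun i j h =>
          le_of_not_gt fun hlt => (h3 j i hlt).not_ge h
        have hm' : MonoAlong (tight r u) w := fun i j h => by
          by_cases he : ν i = ν j
          · exact (h1 i j ⟨h, he⟩).le
          · exact (h2 i j h he).le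
        refine ⟨⟨ha, fun i j h => ?_⟩, ?_⟩
        · rcases (hu i j h).lt_or_eq with hlt | he
          · exact (h3 i j hlt).le
          · exact hm' i j ⟨h, he.symm⟩
        · rw [htight w ha, ← tight_toPoint,
            relCone_tight_eq_iff ((monoAlong_toPoint _ _).mpr hm') hν]
          intro i j h
          have : toPoint w i = toPoint w j ↔ w i = w j := by simp [toPoint]
          rw [this]
          exact ⟨fun he => by_contra fun hne => (h2 i j h hne).ne he, fun he => h1 i j ⟨h, he⟩⟩
    rw [hset]
    have h3 := congrArg (Int.cast : ℤ → R) h2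
    push_cast at h3
    rw [h3]
    have h4 : (-1 : R) ^ n * (-1) ^ dim (relCone (tight (tight r u) ν)) =
        (-1) ^ Nat.card (Quot (tight (tight r u) ν)) := by
      have h5 : (-1 : R) ^ n = (-1) ^ (dim (relCone (tight (tight r u) ν)) +
          Nat.card (Quot (tight (tight r u) ν))) := by rw [h1]
      rw [h5, pow_add, mul_right_comm, ← mul_pow]
      simp
    rw [neg_pow q, ← mul_assoc, h4]
  · intro w hw
    rw [Finset.mem_filter] at hw
    rw [Set.Finite.mem_toFinset, mem_faces_iff]
    refine ⟨toPoint w, (monoAlong_toPoint _ _).mpr fun i j h => hw.2.2 i j h.1, ?_⟩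
    rw [tight_toPoint, htight w hw.2.1]

end PosetCone

/-! ### Flags of upper level sets -/

namespace PosetCone
open QuasiSymm

variable {n : ℕ}

open Classical in
/-- The flag of upper level sets of a word, that is, of all sets `F` on which `u` takes larger
values than on the complement. -/
def upperFlag (u : Fin n → ℕ+) : Finset (Finset (Fin n)) :=
  Finset.univ.filter fun F => ∀ i ∈ F, ∀ j ∉ F, u j < u i

theorem mem_upperFlag {u : Fin n → ℕ+} {F : Finset (Fin n)} :
    F ∈ upperFlag u ↔ ∀ i ∈ F, ∀ j ∉ F, u j < u i := by
  simp [upperFlag]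

theorem filter_lt_mem_upperFlag (u : Fin n → ℕ+) (a : ℕ+) :
    (Finset.univ.filter fun i => a < u i) ∈ upperFlag u := by
  rw [mem_upperFlag]
  intro i hi j hj
  simp only [Finset.mem_filter, Finset.mem_univ, true_and, not_lt] at hi hj
  exact hj.trans_lt hi

theorem subset_or_subset_of_mem_upperFlag {u : Fin n → ℕ+} {A B : Finset (Fin n)}
    (hA : A ∈ upperFlag u) (hB : B ∈ upperFlag u) : A ⊆ B ∨ B ⊆ A := by
  rw [mem_upperFlag] at hA hB
  by_contra h
  rw [not_or, Finset.not_subset, Finset.not_subset] at h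
  obtain ⟨⟨a, ha, ha'⟩, b, hb, hb'⟩ := h
  exact lt_asymm (hA a ha b hb') (hB b hb a ha')

theorem isFlag_upperFlag (u : Fin n → ℕ+) : IsFlag (upperFlag u) :=
  ⟨by simp [mem_upperFlag], by simp [mem_upperFlag],
    fun _ hA _ hB => subset_or_subset_of_mem_upperFlag hA hB⟩

theorem sameBlock_upperFlag (u : Fin n → ℕ+) (i j : Fin n) :
    SameBlock (upperFlag u) i j ↔ u i = u j := by
  constructor
  · have key : ∀ i j, SameBlock (upperFlag u) i j → u j ≤ u i := by
      intro i j h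
      by_contra hlt
      have := (h _ (filter_lt_mem_upperFlag u (u i))).mpr (by simpa using hlt)
      simp at this
    exact fun h => le_antisymm (key j i fun F hF => (h F hF).symm) (key i j h)
  · intro h F hF
    rw [mem_upperFlag] at hF
    constructor
    · exact fun hi => by_contra fun hj => (hF i hi j hj).ne h.symm
    · exact fun hj => by_contra fun hi => (hF j hj i hi).ne h

theorem upperFlag_mem_idealFlags_iff (P : PartialOrder (Fin n)) (u : Fin n → ℕ+) :
    upperFlag u ∈ idealFlags P ↔ ∀ i j, P.lt i j → u j ≤ u i := by
  classical
  rw [idealFlags, Finset.mem_filter]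
  simp only [Finset.mem_univ, true_and, isFlag_upperFlag]
  constructor
  · intro h i j hij
    by_contra hlt
    exact h _ (filter_lt_mem_upperFlag u (u i)) i (by simp) j (by simpa using hlt) hij
  · intro h F hF i hi j hj hij
    exact (h i j hij).not_gt (mem_upperFlag.mp hF j hj i hi)

theorem sameBlock_opFlag (𝓕 : Finset (Finset (Fin n))) (i j : Fin n) :
    SameBlock (opFlag 𝓕) i j ↔ SameBlock 𝓕 i j := by
  simp only [SameBlock, opFlag, Finset.mem_image, forall_exists_index, and_imp,
    forall_apply_eq_imp_iff₂, Finset.mem_compl, not_iff_not]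

theorem earlierBlock_opFlag (𝓕 : Finset (Finset (Fin n))) (i j : Fin n) :
    EarlierBlock (opFlag 𝓕) i j ↔ EarlierBlock 𝓕 j i := by
  simp only [EarlierBlock, opFlag, Finset.mem_image, exists_exists_and_eq_and, Finset.mem_compl,
    not_not]
  exact exists_congr fun F => and_congr_right fun _ => and_comm

/-- Each word lies in the relatively open braid cone of exactly one opposite flag. -/
theorem toPoint_mem_openBraidCone_opFlag_iff {𝓕 : Finset (Finset (Fin n))} (h𝓕 : IsFlag 𝓕)
    (u : Fin n → ℕ+) : toPoint u ∈ openBraidCone (opFlag 𝓕) ↔ 𝓕 = upperFlag u := by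
  have hiff : toPoint u ∈ openBraidCone (opFlag 𝓕) ↔ (∀ i j, SameBlock 𝓕 i j → u i = u j) ∧
      ∀ i j, EarlierBlock 𝓕 j i → u i < u j := by
    simp only [openBraidCone, Set.mem_ofPred_eq, sameBlock_opFlag, earlierBlock_opFlag, toPoint,
      Nat.cast_inj, Nat.cast_lt, PNat.coe_inj, PNat.coe_lt_coe]
  rw [hiff]
  constructor
  · rintro ⟨h1, h2⟩
    have hsub : 𝓕 ⊆ upperFlag u := fun F hF =>
      mem_upperFlag.mpr fun i hi j hj => h2 j i ⟨F, hF, hi, hj⟩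
    refine Finset.Subset.antisymm hsub fun F hF => ?_
    -- `F` lies between consecutive members `A ⊆ F ⊆ B` of the flag, and both inclusions being
    -- strict would give two elements of one block on which `u` differs
    obtain ⟨A, hA, hAmax⟩ := (𝓕.filter (· ⊆ F)).exists_max_image Finset.card
      ⟨∅, Finset.mem_filter.mpr ⟨h𝓕.1, Finset.empty_subset _⟩⟩
    obtain ⟨B, hB, hBmin⟩ := (𝓕.filter (F ⊆ ·)).exists_min_image Finset.card
      ⟨Finset.univ, Finset.mem_filter.mpr ⟨h𝓕.2.1, Finset.subset_univ _⟩⟩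
    rw [Finset.mem_filter] at hA hB
    by_contra hFn
    have hFA : ¬ F ⊆ A := fun h => hFn (Finset.Subset.antisymm h hA.2 ▸ hA.1)
    have hBF : ¬ B ⊆ F := fun h => hFn (Finset.Subset.antisymm h hB.2 ▸ hB.1)
    obtain ⟨p, hpF, hpA⟩ := Finset.not_subset.mp hFA
    obtain ⟨s, hsB, hsF⟩ := Finset.not_subset.mp hBF
    refine (mem_upperFlag.mp hF p hpF s hsF).ne' (h1 p s fun D hD => ?_)
    rcases subset_or_subset_of_mem_upperFlag (hsub hD) hF with h | h
    · have hDA : D ⊆ A := by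
        rcases h𝓕.2.2 D hD A hA.1 with h' | h'
        · exact h'
        · exact (Finset.eq_of_subset_of_card_le h'
            (hAmax D (Finset.mem_filter.mpr ⟨hD, h⟩))).ge
      exact iff_of_false (fun hp => hpA (hDA hp)) (fun hs => hsF (h hs))
    · have hBD : B ⊆ D := by
        rcases h𝓕.2.2 D hD B hB.1 with h' | h'
        · exact (Finset.eq_of_subset_of_card_le h'
            (hBmin D (Finset.mem_filter.mpr ⟨hD, h⟩))).ge
        · exact h'
      exact iff_of_true (h hpF) (hBD hsB)
  · rintro rfl
    exact ⟨fun i j => (sameBlock_upperFlag u i j).mp,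
      fun i j ⟨F, hF, hj, hi⟩ => mem_upperFlag.mp hF j hj i hi⟩

theorem posetCone_quotientPoset_upperFlag (P : PartialOrder (Fin n)) (u : Fin n → ℕ+) :
    posetCone (quotientPoset P (upperFlag u)) = relCone (tight P.lt u) := by
  change relCone (fun i j => P.lt i j ∧ SameBlock (upperFlag u) i j) = _
  simp only [sameBlock_upperFlag]
  rfl

open Classical in
/-- A sum over flags of ideals becomes a sum over order reversing words. -/
theorem coeff_sum_flagMonomial {R : Type*} [CommRing R] (P : PartialOrder (Fin n))
    (g : Finset (Finset (Fin n)) → R) (m : ℕ+ →₀ ℕ) :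
    MvPowerSeries.coeff m (∑ 𝓖 ∈ idealFlags P, g 𝓖 • flagMonomial R (opFlag 𝓖)) =
      ∑ u ∈ words n m, if ∀ i j, P.lt i j → u j ≤ u i then g (upperFlag u) else 0 := by
  rw [map_sum]
  have h1 : ∀ 𝓖 ∈ idealFlags P, MvPowerSeries.coeff m (g 𝓖 • flagMonomial R (opFlag 𝓖)) =
      ∑ u ∈ words n m, if 𝓖 = upperFlag u then g 𝓖 else 0 := by
    intro 𝓖 h𝓖
    have hflag : IsFlag 𝓖 := (Finset.mem_filter.mp h𝓖).2.1
    rw [MvPowerSeries.coeff_smul, flagMonomial, coeff_enumerator, Finset.card_filter,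
      Nat.cast_sum, Finset.mul_sum]
    refine Finset.sum_congr rfl fun u _ => ?_
    rw [toPoint_mem_openBraidCone_opFlag_iff hflag]
    split_ifs <;> simp
  rw [Finset.sum_congr rfl h1, Finset.sum_comm]
  refine Finset.sum_congr rfl fun u _ => ?_
  rw [Finset.sum_ite_eq']
  simp only [upperFlag_mem_idealFlags_iff]

end PosetCone
end

theorem mainTheorem4 {R : Type*} [CommRing R] (q : R) (n : ℕ) (P : PartialOrder (Fin n)) :
    ∃ hF : PosetCone.weightedEnumerator q (PosetCone.posetCone P) ∈ QuasiSymm.QSym R,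
      ((HopfAlgebra.antipode R
          (⟨PosetCone.weightedEnumerator q (PosetCone.posetCone P), hF⟩ : QuasiSymm.QSym R) :
          QuasiSymm.QSym R) : MvPowerSeries ℕ+ R) =
        (-1 : R) ^ n • ∑ 𝓖 ∈ PosetCone.idealFlags P,
          Polynomial.aeval (-q)
            (PosetCone.fPolynomial (PosetCone.posetCone (PosetCone.quotientPoset P 𝓖))) •
          PosetCone.flagMonomial R (PosetCone.opFlag 𝓖) := by
  classical
  have hc := PosetCone.orderInvariant_wordWeight q P.lt
  have hW : PosetCone.weightedEnumerator q (PosetCone.posetCone P) =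
      QuasiSymm.wordSeries (PosetCone.wordWeight q P.lt) :=
    PosetCone.weightedEnumerator_relCone q P.lt
  refine ⟨hW ▸ QuasiSymm.wordSeries_mem_QSym hc, ?_⟩
  simp only [hW]
  ext m
  rw [QuasiSymm.coeff_antipode_wordSeries hc, MvPowerSeries.coeff_smul,
    PosetCone.coeff_sum_flagMonomial P, Finset.mul_sum]
  refine Finset.sum_congr rfl fun u _ => ?_
  split_ifs with hu
  · rw [PosetCone.posetCone_quotientPoset_upperFlag,
      ← PosetCone.sum_packedWords_wordWeight q hu]
  · -- if `u` is not order reversing, no order preserving word is compatible with it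
    rw [mul_zero]
    refine Finset.sum_eq_zero fun w hw => ?_
    rw [PosetCone.wordWeight, if_neg, mul_zero]
    exact fun hm => hu fun i j hij => (Finset.mem_filter.mp hw).2 i j (hm i j hij)
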